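/- Let $n\ge 0$, $X=\{1,\dots,n\}$, and let $X'=\{1',\dots,n'\}$ be a disjoint copy of $X$. The partition monoid $\mathcal P_n$ consists of all partitions of $X\cup X'$. The product $ab$ is formed by drawing $a$ above $b$, identifying the lower row of $a$ with the upper row of $b$, taking connected components, and deleting the middle row. The partial Brauer monoid $\mathcal{PB}_n$ and the Brauer monoid $\mathcal B_n$ are the submonoids of those partitions all of whose blocks have size at most $2$, respectively exactly $2$. For elements $a,b$ of a finite monoid $S$, let $a^{\omega}$ be the identity of the maximal subgroup of $S$ that contains some positive power of $a$ (that is, the idempotent positive power of $a$), and let $a^{\omega+1}=a^{\omega}a$. Write $a\sim_p b$ if $a=uv$ and $b=vu$ for some $u,v\in S$, and let $\sim_{p*}$ be the transitive closure of $\sim_p$ in $S$. Write $a\sim_{tr} b$ if there are $g,h\in S$ with $ghg=g$, $hgh=h$, $gh=a^{\omega}$, $hg=b^{\omega}$ and $h\,a^{\omega+1}g=b^{\omega+1}$. A block of $c\in\mathcal P_n$ is transversal if it meets both $X$ and $X'$. Let $\ker(c)$ and $\operatorname{coker}^{\wedge}(c)$ be the equivalence relations on $X$ given by $x\sim y$ iff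 $x,y$ lie in the same block of $c$, respectively iff $x',y'$ lie in the same block of $c$. If $c$ lies in a subgroup of $\mathcal P_n$, let $P_1,\dots,P_m$ ($m\ge 0$) be the classes of the join $\ker(c)\vee\operatorname{coker}^{\wedge}(c)$ that meet a transversal block of $c$. There is then a unique permutation $\tau_c$ of $\{1,\dots,m\}$ such that $\tau_c$ maps $i$ to $j$ if and only if $c$ has a transversal block $A\cup B'$ with $A\subseteq P_i$ and $B\subseteq P_j$. The cycle type of $c$ is the cycle type of $\tau_c$, that is, the numbers of its cycles of each length, fixed points included. Theorem. Let $S$ be any of the monoids $\mathcal P_n$, $\mathcal{PB}_n$, $\mathcal B_n$. Then in $S$ the relations $\sim_{p*}$ and $\sim_{tr}$ (both defined with $u,v,g,h$ ranging over $S$) are equal. Moreover, for all $a,b\in S$, $a\sim_{p*}b$ if and only if $a^{\omega+1}$ and $b^{\omega+1}$ have the same cycle type. -/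

import Mathlib

/-! ### Conjugacies in monoids and epigroups -/

namespace SemigroupConj

variable {S : Type*} [Monoid S]

/-- Green's relation `R` in a monoid: `a` and `b` generate the same principal right ideal. -/
def GreenR (a b : S) : Prop := (∃ x, b * x = a) ∧ ∃ y, a * y = b

/-- Green's relation `L` in a monoid: `a` and `b` generate the same principal left ideal. -/
def GreenL (a b : S) : Prop := (∃ x, x * b = a) ∧ ∃ y, y * a = b

/-- Green's relation `H`. -/
def GreenH (a b : S) : Prop := GreenR a b ∧ GreenL a b

/-- `a` is a group element: it lies in the `H`-class of an idempotent (a maximal subgroup). -/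
def IsGroupElement (a : S) : Prop := ∃ e : S, IsIdempotentElem e ∧ GreenH a e

/-- `e` is the identity of a maximal subgroup that contains a positive power of `a`. -/
def IsOmega (a e : S) : Prop := IsIdempotentElem e ∧ ∃ k : ℕ, 0 < k ∧ GreenH (a ^ k) e

/-- An epigroup: every element has a positive power lying in a subgroup. -/
class IsEpigroup (S : Type*) [Monoid S] : Prop where
  exists_isOmega : ∀ a : S, ∃ e : S, IsOmega a e

/-- `a ^ ω`: the identity of the maximal subgroup that contains a power of `a`. -/
noncomputable def omega [IsEpigroup S] (a : S) : S :=
  Classical.choose (IsEpigroup.exists_isOmega a)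

theorem isOmega_omega [IsEpigroup S] (a : S) : IsOmega a (omega a) :=
  Classical.choose_spec (IsEpigroup.exists_isOmega a)

/-- `a ^ (ω + 1) = a ^ ω * a`. -/
noncomputable def omegaSucc [IsEpigroup S] (a : S) : S := omega a * a

/-- Primary conjugacy in a monoid (where `S¹ = S`). -/
def PrimaryConj (a b : S) : Prop := ∃ u v : S, a = u * v ∧ b = v * u

/-- The transitive closure of primary conjugacy. -/
def PrimaryConjStar (a b : S) : Prop := Relation.TransGen PrimaryConj a b

/-- Trace conjugacy in a monoid (where `S¹ = S`) that is an epigroup. -/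
def TraceConj [IsEpigroup S] (a b : S) : Prop :=
  ∃ g h : S, g * h * g = g ∧ h * g * h = h ∧ g * h = omega a ∧ h * g = omega b ∧
    h * omegaSucc a * g = omegaSucc b

theorem GreenH.pow {x e : S} (he : IsIdempotentElem e) (h : GreenH x e) (m : ℕ) (hm : 0 < m) :
    GreenH (x ^ m) e := by
  obtain ⟨⟨⟨r, hr⟩, s, hs⟩, ⟨t, ht⟩, w, hw⟩ := h
  have ex : e * x = x := by rw [← hr, ← mul_assoc, he.eq]
  have xe : x * e = x := by rw [← ht, mul_assoc, he.eq]
  obtain ⟨m, rfl⟩ : ∃ k, m = k + 1 := ⟨m - 1, by omega⟩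
  clear hm
  induction m with
  | zero => simpa using ⟨⟨⟨r, hr⟩, s, hs⟩, ⟨t, ht⟩, w, hw⟩
  | succ m ih =>
    obtain ⟨⟨-, s', hs'⟩, -, w', hw'⟩ := ih
    refine ⟨⟨⟨x ^ (m + 2), ?_⟩, s' * s, ?_⟩, ⟨x ^ (m + 2), ?_⟩, w * w', ?_⟩
    · rw [pow_succ' x (m + 1), ← mul_assoc, ex]
    · rw [pow_succ' x (m + 1), mul_assoc, ← mul_assoc _ s' s, hs', ← mul_assoc, xe, hs]
    · rw [pow_succ x (m + 1), mul_assoc, xe]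
    · rw [pow_succ x (m + 1), mul_assoc, ← mul_assoc w', hw', ex, hw]

/-- The idempotent in the definition of `omega` is unique. -/
theorem IsOmega.unique {a e f : S} (he : IsOmega a e) (hf : IsOmega a f) : e = f := by
  obtain ⟨ie, k, hk, hke⟩ := he
  obtain ⟨jf, l, hl, hlf⟩ := hf
  have h1 := hke.pow ie l hl
  have h2 := hlf.pow jf k hk
  rw [← pow_mul] at h1 h2
  rw [mul_comm l k] at h2
  obtain ⟨⟨⟨r, hr⟩, s, hs⟩, ⟨t, ht⟩, w, hw⟩ := h1
  obtain ⟨⟨⟨r', hr'⟩, s', hs'⟩, ⟨t', ht'⟩, w', hw'⟩ := h2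
  have fa : f * a ^ (k * l) = a ^ (k * l) := by rw [← hr', ← mul_assoc, jf.eq]
  have ae : a ^ (k * l) * e = a ^ (k * l) := by rw [← ht, mul_assoc, ie.eq]
  have h3 : f * e = e := by rw [← hs, ← mul_assoc, fa]
  have h4 : f * e = f := by rw [← hw', mul_assoc, ae]
  exact h3.symm.trans h4

instance instIsEpigroupOfFinite [Finite S] : IsEpigroup S where
  exists_isOmega a := by
    obtain ⟨i, j, hij, h⟩ := Finite.exists_ne_map_eq_of_infinite (fun i : ℕ => a ^ (i + 1))
    wlog hlt : i < j generalizing i j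
    · exact this j i hij.symm h.symm (by omega)
    have per : ∀ t k : ℕ, i + 1 ≤ k → a ^ (k + t * (j - i)) = a ^ k := by
      intro t k hk
      induction t with
      | zero => simp
      | succ t ih =>
        have e1 : k + (t + 1) * (j - i) = (k - (i + 1) + t * (j - i)) + (j + 1) := by
          rw [add_mul]; omega
        have e2 : k + t * (j - i) = (k - (i + 1) + t * (j - i)) + (i + 1) := by omega
        have h' : a ^ (i + 1) = a ^ (j + 1) := h
        rw [e1, pow_add, ← h', ← pow_add, ← e2, ih]
    have hN : i + 1 ≤ (i + 1) * (j - i) := Nat.le_mul_of_pos_right _ (by omega)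
    refine ⟨a ^ ((i + 1) * (j - i)), ?_, (i + 1) * (j - i), by omega,
      ⟨⟨1, by simp⟩, 1, by simp⟩, ⟨1, by simp⟩, 1, by simp⟩
    change _ * _ = _
    rw [← pow_add]
    exact per _ _ hN

end SemigroupConj

/-! ### The partition monoid -/

/-- The underlying set of the partition monoid: partitions (as equivalence relations) of
`X ∪ X'`, `X` having `n` elements. Here `Sum.inl x` is the upper vertex `x` and `Sum.inr x` is the
lower vertex `x'`. -/
def PartitionMonoid (n : ℕ) : Type := Setoid (Fin n ⊕ Fin n)

namespace PartitionMonoid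

open Relation

variable {n : ℕ}

/-- `a.Rel p q`: the vertices `p` and `q` lie in the same block of `a`. -/
def Rel (a : PartitionMonoid n) (p q : Fin n ⊕ Fin n) : Prop := Setoid.r (self := a) p q

theorem rel_refl (a : PartitionMonoid n) (p) : a.Rel p p := Setoid.refl' a p
theorem rel_symm (a : PartitionMonoid n) {p q} (h : a.Rel p q) : a.Rel q p := Setoid.symm' a h
theorem rel_trans (a : PartitionMonoid n) {p q r} (h : a.Rel p q) (h' : a.Rel q r) : a.Rel p r :=
  Setoid.trans' a h h'

theorem ext_rel {a b : PartitionMonoid n} (h : ∀ p q, a.Rel p q ↔ b.Rel p q) : a = b :=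
  Setoid.ext h

/-- The three rows of vertices (top, middle, bottom) of the diagram of `a` drawn over `b`. -/
abbrev Rows (n : ℕ) : Type := Fin n ⊕ Fin n ⊕ Fin n

/-- The vertices of the upper diagram are placed in the top and middle rows. -/
def up : Fin n ⊕ Fin n → Rows n
  | .inl x => .inl x
  | .inr x => .inr (.inl x)

/-- The vertices of the lower diagram are placed in the middle and bottom rows. -/
def low : Fin n ⊕ Fin n → Rows n := Sum.inr

/-- The vertices of the product are the top and bottom rows. -/
def outer : Fin n ⊕ Fin n → Rows n
  | .inl x => .inl x
  | .inr x => .inr (.inr x)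

/-- The edges of `a` drawn over `b`, with the lower row of `a` glued to the upper row of `b`. -/
inductive Stack (a b : PartitionMonoid n) : Rows n → Rows n → Prop
  | up {p q : Fin n ⊕ Fin n} : a.Rel p q → Stack a b (up p) (up q)
  | low {p q : Fin n ⊕ Fin n} : b.Rel p q → Stack a b (low p) (low q)

/-- The partition of the three rows into the connected components of the stacked diagram. -/
def stackSetoid (a b : PartitionMonoid n) : Setoid (Rows n) := EqvGen.setoid (Stack a b)

/-- The product of partitions: connected components of the stacked diagram, with the middle row
removed. -/
instance : Mul (PartitionMonoid n) := ⟨fun a b => Setoid.comap outer (stackSetoid a b)⟩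

/-- The identity has the blocks `{x, x'}`. -/
instance : One (PartitionMonoid n) := ⟨Setoid.ker (Sum.elim id id)⟩

theorem mul_rel {a b : PartitionMonoid n} {p q} :
    (a * b).Rel p q ↔ stackSetoid a b (outer p) (outer q) := Iff.rfl

theorem one_rel {p q : Fin n ⊕ Fin n} :
    (1 : PartitionMonoid n).Rel p q ↔ Sum.elim id id p = Sum.elim id id q := Iff.rfl

theorem stack_le {a b : PartitionMonoid n} {s : Setoid (Rows n)}
    (h1 : ∀ p q, a.Rel p q → s (up p) (up q)) (h2 : ∀ p q, b.Rel p q → s (low p) (low q)) {x y}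
    (h : stackSetoid a b x y) : s x y := by
  refine (Setoid.eqvGen_le (r := Stack a b) (s := s) ?_) h
  rintro _ _ (h | h)
  · exact h1 _ _ h
  · exact h2 _ _ h

theorem stack_up {a b : PartitionMonoid n} {p q} (h : a.Rel p q) :
    stackSetoid a b (up p) (up q) := EqvGen.rel _ _ (.up h)

theorem stack_low {a b : PartitionMonoid n} {p q} (h : b.Rel p q) :
    stackSetoid a b (low p) (low q) := EqvGen.rel _ _ (.low h)

/-- The upside-down diagram. -/
def flip (a : PartitionMonoid n) : PartitionMonoid n := Setoid.comap Sum.swap a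

theorem flip_rel {a : PartitionMonoid n} {p q} : a.flip.Rel p q ↔ a.Rel p.swap q.swap := Iff.rfl

theorem flip_flip (a : PartitionMonoid n) : a.flip.flip = a :=
  ext_rel fun p q => by simp [flip_rel]

theorem flip_mul_le {a b : PartitionMonoid n} {p q} (h : (a * b).Rel p q) :
    (b.flip * a.flip).Rel p.swap q.swap := by
  let ρ : Rows n → Rows n
    | .inl x => .inr (.inr x)
    | .inr (.inl x) => .inr (.inl x)
    | .inr (.inr x) => .inl x
  have ho : ∀ p, outer (Sum.swap p) = ρ (outer p) := by rintro (x | x) <;> rfl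
  have hu : ∀ p, low (Sum.swap p) = ρ (up p) := by rintro (x | x) <;> rfl
  have hl : ∀ p, up (Sum.swap p) = ρ (low p) := by rintro (x | x) <;> rfl
  rw [mul_rel, ho, ho]
  refine stack_le (s := Setoid.comap ρ (stackSetoid b.flip a.flip)) ?_ ?_ h
  · intro p q h
    change stackSetoid _ _ _ _
    rw [← hu, ← hu]
    exact stack_low (by simpa [flip_rel] using h)
  · intro p q h
    change stackSetoid _ _ _ _
    rw [← hl, ← hl]
    exact stack_up (by simpa [flip_rel] using h)

theorem flip_mul (a b : PartitionMonoid n) : (a * b).flip = b.flip * a.flip := by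
  refine ext_rel fun p q => ⟨fun h => ?_, fun h => ?_⟩
  · simpa using flip_mul_le (flip_rel.1 h)
  · rw [flip_rel]
    simpa [flip_flip] using flip_mul_le h

theorem flip_one : (1 : PartitionMonoid n).flip = 1 :=
  ext_rel fun p q => by rw [flip_rel, one_rel, one_rel]; rcases p with p | p <;>
    rcases q with q | q <;> rfl

theorem mul_one' (a : PartitionMonoid n) : a * 1 = a := by
  have hb : ∀ p : Fin n ⊕ Fin n, stackSetoid a 1 (up p) (outer p) := by
    rintro (x | x)
    · exact Setoid.refl' _ _
    · exact stack_low (a := a) (p := .inl x) (q := .inr x) rfl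
  refine ext_rel fun p q => ⟨fun h => ?_, fun h => ?_⟩
  · let ρ : Rows n → Fin n ⊕ Fin n
      | .inl x => .inl x
      | .inr (.inl x) => .inr x
      | .inr (.inr x) => .inr x
    have ho : ∀ p, ρ (outer p) = p := by rintro (x | x) <;> rfl
    have hu : ∀ p, ρ (up p) = p := by rintro (x | x) <;> rfl
    have hl : ∀ p, ρ (low p) = .inr (Sum.elim id id p) := by rintro (x | x) <;> rfl
    have := stack_le (s := Setoid.comap ρ a) ?_ ?_ h
    · change a.Rel _ _ at this
      rwa [ho, ho] at this
    · intro p q h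
      change a.Rel _ _
      rwa [hu, hu]
    · intro p q h
      change a.Rel _ _
      rw [hl, hl, one_rel.1 h]
      exact a.rel_refl _
  · exact Setoid.trans' (stackSetoid a 1) (Setoid.symm' _ (hb p)) (Setoid.trans' _ (stack_up h) (hb q))

/-- Auxiliary for associativity: `x` and `y` have links to the same class of `s`, or to none. -/
def linkSetoid {A W : Type*} (L : A → W → Prop) (s : Setoid W)
    (hL : ∀ x w w', L x w → L x w' → s w w') : Setoid A where
  r x y := ((∃ w, L x w) ↔ ∃ w, L y w) ∧ ∀ w w', L x w → L y w' → s w w'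
  iseqv :=
    { refl := fun x => ⟨Iff.rfl, hL x⟩
      symm := fun h => ⟨h.1.symm, fun w w' h1 h2 => Setoid.symm' s (h.2 w' w h2 h1)⟩
      trans := fun {x y z} h h' => ⟨h.1.trans h'.1, fun w w' h1 h2 => by
        obtain ⟨v, hv⟩ := h.1.1 ⟨w, h1⟩
        exact Setoid.trans' s (h.2 _ _ h1 hv) (h'.2 _ _ hv h2)⟩ }

theorem mul_assoc_le {a b c : PartitionMonoid n} {p q} (h : (a * b * c).Rel p q) :
    (a * (b * c)).Rel p q := by
  -- a vertex `x` of `b` over `c` is linked to the outer vertices of its component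
  let K : Rows n → Rows n → Prop := fun x w => ∃ o, stackSetoid b c x (outer o) ∧ w = low o
  have hK : ∀ x y, stackSetoid b c x y → ((∃ w, K x w) ↔ ∃ w, K y w) ∧
      ∀ w w', K x w → K y w' → stackSetoid a (b * c) w w' := by
    intro x y hxy
    refine ⟨⟨?_, ?_⟩, ?_⟩
    · rintro ⟨w, o, ho, rfl⟩
      exact ⟨_, o, Setoid.trans' _ (Setoid.symm' _ hxy) ho, rfl⟩
    · rintro ⟨w, o, ho, rfl⟩
      exact ⟨_, o, Setoid.trans' _ hxy ho, rfl⟩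
    · rintro _ _ ⟨o, ho, rfl⟩ ⟨o', ho', rfl⟩
      exact stack_low (mul_rel.2
        (Setoid.trans' _ (Setoid.symm' _ ho) (Setoid.trans' _ hxy ho')))
  let L2 : Rows n → Rows n → Prop := fun x w =>
    Sum.elim (fun x => w = Sum.inl x) (fun z => K (up z) w) x
  let L : Rows n → Rows n → Prop := fun x w =>
    Sum.elim (fun x => w = Sum.inl x) (fun z => K (Sum.inr z) w) x
  have hL2 : ∀ x w w', L2 x w → L2 x w' → stackSetoid a (b * c) w w' := by
    rintro (x | z) w w' h1 h2
    · cases h1; cases h2; exact Setoid.refl' _ _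
    · exact (hK _ _ (Setoid.refl' _ _)).2 _ _ h1 h2
  have hL : ∀ x w w', L x w → L x w' → stackSetoid a (b * c) w w' := by
    rintro (x | z) w w' h1 h2
    · cases h1; cases h2; exact Setoid.refl' _ _
    · exact (hK _ _ (Setoid.refl' _ _)).2 _ _ h1 h2
  have L2up : ∀ p, L2 (up p) (up p) := by
    rintro (x | x)
    · rfl
    · exact ⟨.inl x, Setoid.refl' _ _, rfl⟩
  have Lout : ∀ p, L (outer p) (outer p) := by
    rintro (x | x)
    · rfl
    · exact ⟨.inr x, Setoid.refl' _ _, rfl⟩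
  have LL2 : ∀ p w, L (up p) w ↔ L2 (outer p) w := by rintro (x | x) w <;> rfl
  have step2 : ∀ x y, stackSetoid a b x y → linkSetoid L2 _ hL2 x y := by
    intro x y hxy
    refine stack_le ?_ ?_ hxy
    · intro p q h
      refine ⟨⟨fun _ => ⟨_, L2up q⟩, fun _ => ⟨_, L2up p⟩⟩, fun w w' h1 h2 => ?_⟩
      exact Setoid.trans' _ (hL2 _ _ _ h1 (L2up p))
        (Setoid.trans' _ (stack_up h) (hL2 _ _ _ (L2up q) h2))
    · intro p q h
      exact hK _ _ (stack_up h)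
  have step : linkSetoid L _ hL (outer p) (outer q) := by
    refine stack_le ?_ ?_ h
    · intro p q h
      have := step2 _ _ (mul_rel.1 h)
      refine ⟨?_, fun w w' h1 h2 => this.2 _ _ ((LL2 _ _).1 h1) ((LL2 _ _).1 h2)⟩
      simp only [LL2]
      exact this.1
    · intro p q h
      exact hK _ _ (stack_low h)
  exact step.2 _ _ (Lout p) (Lout q)

instance : Monoid (PartitionMonoid n) where
  mul_assoc a b c := ext_rel fun p q => ⟨mul_assoc_le, fun h => by
    have h' : (a * (b * c)).flip.Rel p.swap q.swap := by simpa [flip_rel] using h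
    rw [flip_mul, flip_mul] at h'
    have := mul_assoc_le h'
    rw [← flip_mul, ← flip_mul] at this
    simpa [flip_rel] using this⟩
  one_mul a := by
    have := congrArg flip (mul_one' a.flip)
    rwa [flip_mul, flip_one, flip_flip] at this
  mul_one := mul_one'

instance : Finite (PartitionMonoid n) :=
  Finite.of_injective (fun a : PartitionMonoid n => fun p q => a.Rel p q) fun _ _ h =>
    ext_rel fun p q => iff_of_eq (congrFun (congrFun h p) q)

/-! ### Brauer monoids -/

/-- The block of `a` containing the vertex `p`. -/
def block (a : PartitionMonoid n) (p : Fin n ⊕ Fin n) : Set (Fin n ⊕ Fin n) := {q | a.Rel p q}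

section Counting

open Classical

theorem card_le_of_connected {V : Type*} [Fintype V] (G : SimpleGraph V) (hG : G.Connected)
    (d : V → ℕ) (hd : ∀ v, (G.neighborSet v).ncard ≤ d v) :
    2 * Fintype.card V ≤ (∑ v, d v) + 2 := by
  have h1 := hG.card_vert_le_card_edgeSet_add_one
  have h2 := G.sum_degrees_eq_twice_card_edges
  have h3 : ∑ v, G.degree v ≤ ∑ v, d v := Finset.sum_le_sum fun v _ => by
    refine le_trans (le_of_eq ?_) (hd v)
    rw [← G.card_neighborSet_eq_degree, ← Nat.card_eq_fintype_card, Nat.card_coe_set_eq]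
  rw [Nat.card_eq_fintype_card, Nat.card_eq_fintype_card, ← SimpleGraph.edgeFinset_card] at h1
  omega

variable (a b : PartitionMonoid n) (x : Rows n)

/-- The number of vertices `f v`, with `v` in a given family, in the component of `x`. -/
noncomputable def cnt {V : Type*} [Fintype V] (f : V → Rows n) : ℕ :=
  (Finset.univ.filter fun v => stackSetoid a b x (f v)).card

theorem cnt_sum {V W : Type*} [Fintype V] [Fintype W] (f : V ⊕ W → Rows n) :
    cnt a b x f = cnt a b x (f ∘ Sum.inl) + cnt a b x (f ∘ Sum.inr) := by
  simp only [cnt, Finset.card_filter, Fintype.sum_sum_type, Function.comp_def]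

theorem even_of_blocks (c : PartitionMonoid n) (hc : ∀ p, (c.block p).ncard = 2)
    (P : Fin n ⊕ Fin n → Prop) (hP : ∀ p q, c.Rel p q → P p → P q) :
    Even (Finset.univ.filter P).card := by
  let m : Fin n ⊕ Fin n → Quotient (show Setoid (Fin n ⊕ Fin n) from c) := Quotient.mk _
  rw [Finset.card_eq_sum_card_image m]
  refine Finset.even_sum _ fun t ht => ?_
  obtain ⟨p, hp, rfl⟩ := Finset.mem_image.1 ht
  have : (Finset.filter (fun v => m v = m p) (Finset.filter P Finset.univ)).card = 2 := by
    rw [← hc p, ← Set.ncard_coe_finset]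
    congr 1
    ext q
    have hm : m q = m p ↔ c.Rel q p := Quotient.eq (r := (show Setoid (Fin n ⊕ Fin n) from c))
    simp only [Finset.coe_filter, Finset.mem_filter, Finset.mem_univ, true_and,
      Set.mem_ofPred_eq, hm, block]
    exact ⟨fun h => c.rel_symm h.2,
      fun h => ⟨hP _ _ h (by simpa using hp), c.rel_symm h⟩⟩
  rw [this]
  exact even_two

theorem even_outer (ha : ∀ p, (a.block p).ncard = 2) (hb : ∀ p, (b.block p).ncard = 2) :
    Even (cnt a b x outer) := by
  have h1 : Even (cnt a b x up) := even_of_blocks a ha _ fun p q h h' =>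
    Setoid.trans' _ h' (stack_up h)
  have h2 : Even (cnt a b x low) := even_of_blocks b hb _ fun p q h h' =>
    Setoid.trans' _ h' (stack_low h)
  rw [cnt_sum] at h1 h2 ⊢
  change Even (cnt a b x Sum.inl + cnt a b x (Sum.inr ∘ Sum.inl)) at h1
  change Even (cnt a b x (Sum.inr ∘ Sum.inl) + cnt a b x (Sum.inr ∘ Sum.inr)) at h2
  change Even (cnt a b x Sum.inl + cnt a b x (Sum.inr ∘ Sum.inr))
  rw [Nat.even_add] at *
  tauto

/-- The stacked diagram as a simple graph. -/
def stackGraph : SimpleGraph (Rows n) := SimpleGraph.fromRel (Stack a b)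

theorem stackGraph_reachable {y : Rows n} :
    (stackGraph a b).Reachable x y ↔ stackSetoid a b x y := by
  constructor
  · rintro ⟨w⟩
    induction w with
    | nil => exact Setoid.refl' _ _
    | cons h _ ih =>
      refine Setoid.trans' _ ?_ ih
      rcases h.2 with h | h
      · exact EqvGen.rel _ _ h
      · exact Setoid.symm' _ (EqvGen.rel _ _ h)
  · intro h
    refine Setoid.eqvGen_le (r := Stack a b) (s := (stackGraph a b).reachableSetoid) ?_ h
    intro u v huv
    change (stackGraph a b).Reachable u v
    by_cases e : u = v
    · rw [e]
    · exact SimpleGraph.Adj.reachable ⟨e, Or.inl huv⟩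

theorem stackGraph_adj {v w : Rows n} (h : (stackGraph a b).Adj v w) :
    (∃ p, v = up p ∧ w ∈ up '' (a.block p \ {p})) ∨
      ∃ p, v = low p ∧ w ∈ low '' (b.block p \ {p}) := by
  obtain ⟨hne, h⟩ := h
  have aux : Stack a b v w := by
    rcases h with h | h
    · exact h
    · rcases h with h | h
      · exact .up (a.rel_symm h)
      · exact .low (b.rel_symm h)
  clear h
  rcases aux with @⟨p, q, h⟩ | @⟨p, q, h⟩
  · exact .inl ⟨p, rfl, q, ⟨h, fun e => hne (by rw [Set.mem_singleton_iff.1 e])⟩, rfl⟩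
  · exact .inr ⟨p, rfl, q, ⟨h, fun e => hne (by rw [Set.mem_singleton_iff.1 e])⟩, rfl⟩

theorem ncard_image_block_le (c : PartitionMonoid n) (hc : ∀ p, (c.block p).ncard ≤ 2)
    (f : Fin n ⊕ Fin n → Rows n) (p) : (f '' (c.block p \ {p})).ncard ≤ 1 := by
  refine (Set.ncard_image_le (Set.toFinite _)).trans ?_
  rw [Set.ncard_sdiff_singleton_of_mem (show p ∈ c.block p from c.rel_refl p)]
  have := hc p
  omega

/-- A bound for the degrees in the stacked diagram of two partial Brauer diagrams. -/
def degBound : Rows n → ℕ := Sum.elim (fun _ => 1) (Sum.elim (fun _ => 2) fun _ => 1)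

theorem ncard_neighborSet_le (ha : ∀ p, (a.block p).ncard ≤ 2) (hb : ∀ p, (b.block p).ncard ≤ 2)
    (v : Rows n) : ((stackGraph a b).neighborSet v).ncard ≤ degBound v := by
  have hu := fun p => ncard_image_block_le a ha up p
  have hl := fun p => ncard_image_block_le b hb low p
  rcases v with v | v | v
  · have hs : (stackGraph a b).neighborSet (.inl v) ⊆ up '' (a.block (.inl v) \ {.inl v}) := by
      intro w hw
      rcases stackGraph_adj a b hw with ⟨p | p, hp, h⟩ | ⟨p, hp, h⟩
      · simp only [up, Sum.inl.injEq] at hp; subst hp; exact h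
      · simp [up] at hp
      · simp [low] at hp
    exact (Set.ncard_le_ncard hs (Set.toFinite _)).trans (hu _)
  · have hs : (stackGraph a b).neighborSet (.inr (.inl v)) ⊆
        up '' (a.block (.inr v) \ {.inr v}) ∪ low '' (b.block (.inl v) \ {.inl v}) := by
      intro w hw
      rcases stackGraph_adj a b hw with ⟨p | p, hp, h⟩ | ⟨p, hp, h⟩
      · simp [up] at hp
      · simp only [up, Sum.inr.injEq, Sum.inl.injEq] at hp; subst hp; exact .inl h
      · simp only [low, Sum.inr.injEq] at hp; subst hp; exact .inr h
    exact (Set.ncard_le_ncard hs (Set.toFinite _)).trans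
      ((Set.ncard_union_le _ _).trans (add_le_add (hu _) (hl _)))
  · have hs : (stackGraph a b).neighborSet (.inr (.inr v)) ⊆
        low '' (b.block (.inr v) \ {.inr v}) := by
      intro w hw
      rcases stackGraph_adj a b hw with ⟨p | p, hp, h⟩ | ⟨p, hp, h⟩
      · simp [up] at hp
      · simp [up] at hp
      · simp only [low, Sum.inr.injEq] at hp; subst hp; exact h
    exact (Set.ncard_le_ncard hs (Set.toFinite _)).trans (hl _)

theorem cnt_outer_le (ha : ∀ p, (a.block p).ncard ≤ 2) (hb : ∀ p, (b.block p).ncard ≤ 2) :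
    cnt a b x outer ≤ 2 := by
  let C : Set (Rows n) := {y | stackSetoid a b x y}
  have hC : ((stackGraph a b).induce C).Connected := by
    have : C = ((stackGraph a b).connectedComponentMk x).supp := by
      ext y
      rw [SimpleGraph.ConnectedComponent.mem_supp_iff, SimpleGraph.ConnectedComponent.eq,
        SimpleGraph.reachable_comm, stackGraph_reachable]
      rfl
    rw [this]
    exact SimpleGraph.ConnectedComponent.connected_toSimpleGraph _
  have h := card_le_of_connected _ hC (fun v => degBound v.1) fun v => by
    refine le_trans ?_ (ncard_neighborSet_le a b ha hb v.1)
    rw [← Set.ncard_image_of_injective _ Subtype.val_injective]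
    refine Set.ncard_le_ncard ?_ (Set.toFinite _)
    rintro _ ⟨w, hw, rfl⟩
    exact hw
  have h1 : Fintype.card C = cnt a b x id := by
    rw [cnt, Fintype.card_subtype]
    rfl
  have h2 : ∑ v : C, degBound v.1 = ∑ v : Rows n, if stackSetoid a b x v then degBound v else 0 := by
    rw [← Finset.sum_filter]
    exact (Finset.sum_subtype _ (fun v => by simp [C]) _).symm
  rw [h1, h2] at h
  rw [cnt_sum]
  change cnt a b x Sum.inl + cnt a b x (Sum.inr ∘ Sum.inr) ≤ 2
  simp only [cnt, Finset.card_filter, Fintype.sum_sum_type, degBound, Sum.elim_inl, Sum.elim_inr,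
    Function.comp_def, id] at h ⊢
  have h3 : ∑ v : Fin n, (if stackSetoid a b x (.inr (.inl v)) then 2 else 0) =
      2 * ∑ v : Fin n, (if stackSetoid a b x (.inr (.inl v)) then 1 else 0) := by
    rw [Finset.mul_sum]
    exact Finset.sum_congr rfl fun v _ => by split_ifs <;> rfl
  rw [h3] at h
  omega

theorem ncard_block_mul (p : Fin n ⊕ Fin n) :
    ((a * b).block p).ncard = cnt a b (outer p) outer := by
  rw [cnt, ← Set.ncard_coe_finset]
  congr 1
  ext q
  simp [block, mul_rel]

end Counting

theorem block_one (p : Fin n ⊕ Fin n) :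
    (1 : PartitionMonoid n).block p =
      {Sum.inl (Sum.elim id id p), Sum.inr (Sum.elim id id p)} := by
  ext q
  rcases p with p | p <;> rcases q with q | q <;>
    simp [block, one_rel, eq_comm]

theorem ncard_block_one (p : Fin n ⊕ Fin n) : ((1 : PartitionMonoid n).block p).ncard = 2 := by
  rw [block_one]
  exact Set.ncard_pair Sum.inl_ne_inr

/-- The partial Brauer monoid: each block has size at most `2`. -/
def PartialBrauer (n : ℕ) : Submonoid (PartitionMonoid n) where
  carrier := {a | ∀ p, (a.block p).ncard ≤ 2}
  one_mem' p := (ncard_block_one p).le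
  mul_mem' {a b} ha hb p := by
    rw [ncard_block_mul]
    exact cnt_outer_le a b _ ha hb

/-- The Brauer monoid: each block has size `2`. -/
def Brauer (n : ℕ) : Submonoid (PartitionMonoid n) where
  carrier := {a | ∀ p, (a.block p).ncard = 2}
  one_mem' p := ncard_block_one p
  mul_mem' {a b} ha hb p := by
    have h1 := cnt_outer_le a b (outer p) (fun p => (ha p).le) (fun p => (hb p).le)
    have h2 := even_outer a b (outer p) ha hb
    rw [← ncard_block_mul] at h1 h2
    have h3 : 0 < ((a * b).block p).ncard :=
      (Set.ncard_pos (Set.toFinite _)).2 ⟨p, (a * b).rel_refl p⟩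
    obtain ⟨k, hk⟩ := h2
    omega

/-! ### Cycle types -/

/-- The kernel of `a`: the equivalence relation on `X` induced by the blocks of `a`. -/
def ker (a : PartitionMonoid n) : Setoid (Fin n) := Setoid.comap Sum.inl a

/-- The cokernel of `a`, as an equivalence relation on `X` (primes removed). -/
def coker (a : PartitionMonoid n) : Setoid (Fin n) := Setoid.comap Sum.inr a

/-- A block `P` of the join of the kernel and the cokernel meets a transversal block of `a`
(in an upper vertex). -/
def MeetsTransversal (a : PartitionMonoid n) (P : Quotient (a.ker ⊔ a.coker)) : Prop :=
  ∃ x y : Fin n, Quotient.mk _ x = P ∧ a.Rel (.inl x) (.inr y)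

/-- The blocks `P₁, …, Pₘ` of the join of the kernel and the cokernel of `a` that meet some
transversal block of `a`. -/
abbrev TransversalClass (a : PartitionMonoid n) : Type :=
  {P : Quotient (a.ker ⊔ a.coker) // a.MeetsTransversal P}

noncomputable instance (a : PartitionMonoid n) : Fintype (TransversalClass a) :=
  Fintype.ofFinite _

noncomputable instance (a : PartitionMonoid n) : DecidableEq (TransversalClass a) :=
  Classical.decEq _

/-- `τ` is the permutation of the classes `P₁, …, Pₘ` that sends `Pᵢ` to `Pⱼ` exactly if `a` has a
transversal block `A ∪ B'` with `A ⊆ Pᵢ` and `B ⊆ Pⱼ`. -/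
def IsTransversalPerm (a : PartitionMonoid n) (τ : Equiv.Perm (TransversalClass a)) : Prop :=
  ∀ P Q : TransversalClass a, τ P = Q ↔
    ∃ x y : Fin n, Quotient.mk _ x = P.1 ∧ Quotient.mk _ y = Q.1 ∧ a.Rel (.inl x) (.inr y)

/-- The group element `a` has cycle type `μ`. Here `μ` is the multiset of the lengths of all
cycles (including those of length `1`) of the permutation `τ` of the transversal classes of `a`,
so `Multiset.count i μ` is the number of cycles of length `i`. -/
def HasCycleType (a : PartitionMonoid n) (μ : Multiset ℕ) : Prop :=
  SemigroupConj.IsGroupElement a ∧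
    ∃ τ : Equiv.Perm (TransversalClass a), IsTransversalPerm a τ ∧ τ.partition.parts = μ

/-- `a` and `b` are group elements of the same cycle type. -/
def SameCycleType (a b : PartitionMonoid n) : Prop := ∃ μ, HasCycleType a μ ∧ HasCycleType b μ

end PartitionMonoid

/-! ### Conjugacy in finite monoids -/

namespace SemigroupConj

variable {S : Type*} [Monoid S]

/-! The proof runs around a circle: `PrimaryConjStar` implies equal cycle types, equal cycle types
imply `TraceConj`, and `TraceConj` implies `PrimaryConjStar`. Transitivity of trace conjugacy is
never proved directly; it is inherited from the cycle type.

Two steps are pure monoid theory. In a finite monoid, `u * v` and `v * u` are trace conjugate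
through explicit words in `u` and `v` (`PrimaryConj.traceConj`). In a finite regular monoid each
element is linked to its group part by primary conjugacies (`primaryConjStar_omegaSucc`), and trace
conjugacy makes group parts primarily conjugate, so it implies `PrimaryConjStar`
(`TraceConj.primaryConjStar`).

The rest is combinatorics. Call the kernel of a partition, with the upper parts of its transversal
blocks, its upper row; the lower row is dual. For an idempotent, and hence for a group element,
every join class that meets a transversal block contains exactly one upper part and one lower part.
Partitions with the upper row of a group element `c` and the lower row of a group element `d`
therefore correspond to bijections between the transversal classes of `c` and `d`
(`exists_realizes_of_rows`, `exists_realizes`), and products with matching middle rows compose the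
bijections (`Realizes.mul`). In this dictionary `omega a` is the identity and `omegaSucc a` is its
permutation, while `g`, `h` are mutually inverse bijections. Trace conjugacy thus says that the two
permutations are conjugate, that is, have equal cycle type.

A submonoid needs only two closure properties: regularity, which comes from flipping diagrams, and
closure under recombining rows, which for the Brauer monoids is a count of block sizes
(`ncard_block_of_rows`). -/

theorem exists_pow_isIdempotentElem [Finite S] (a : S) :
    ∃ N : ℕ, 0 < N ∧ IsIdempotentElem (a ^ N) := by
  obtain ⟨e, he, k, hk, hke⟩ := IsEpigroup.exists_isOmega a
  obtain ⟨i, j, hij, h⟩ := Finite.exists_ne_map_eq_of_infinite (fun i : ℕ => (a ^ k) ^ (i + 1))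
  wlog hlt : i < j generalizing i j
  · exact this j i hij.symm h.symm (by omega)
  obtain ⟨⟨-, s, hs⟩, ⟨t, ht⟩, -⟩ := hke.pow he (i + 1) (by omega)
  -- The repeated power is cancelled inside the maximal subgroup with identity `e`, which leaves `(a
  -- ^ k) ^ (j - i) = e`.
  have h1 : (a ^ k) ^ (j - i) * (a ^ k) ^ (i + 1) = (a ^ k) ^ (i + 1) := by
    rw [← pow_add, show j - i + (i + 1) = j + 1 by omega]
    exact h.symm
  have h2 : (a ^ k) ^ (j - i) * e = e := by rw [← hs, ← mul_assoc, h1]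
  obtain ⟨-, ⟨t', ht'⟩, -⟩ := hke.pow he (j - i) (by omega)
  have h3 : (a ^ k) ^ (j - i) = e := by
    rw [← h2, ← ht', mul_assoc, he.eq]
  refine ⟨k * (j - i), Nat.mul_pos hk (by omega), ?_⟩
  rw [pow_mul, h3]
  exact he

/-- `omega` is a choice, so uniqueness is what makes it computable: an idempotent power lies in its
own `H`-class. -/
theorem omega_eq_pow [IsEpigroup S] {a : S} {N : ℕ} (hN : 0 < N)
    (h : IsIdempotentElem (a ^ N)) : omega a = a ^ N :=
  (isOmega_omega a).unique ⟨h, N, hN, ⟨⟨1, by simp⟩, 1, by simp⟩, ⟨1, by simp⟩, 1, by simp⟩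

theorem exists_common_pow [Finite S] (a b : S) : ∃ N : ℕ, 0 < N ∧
    a ^ N * a ^ N = a ^ N ∧ b ^ N * b ^ N = b ^ N ∧ omega a = a ^ N ∧ omega b = b ^ N := by
  obtain ⟨k, hk, ha⟩ := exists_pow_isIdempotentElem a
  obtain ⟨l, hl, hb⟩ := exists_pow_isIdempotentElem b
  have ha' : IsIdempotentElem (a ^ (k * l)) := by rw [pow_mul]; exact ha.pow l
  have hb' : IsIdempotentElem (b ^ (k * l)) := by rw [mul_comm, pow_mul]; exact hb.pow k
  exact ⟨k * l, Nat.mul_pos hk hl, ha', hb', omega_eq_pow (Nat.mul_pos hk hl) ha',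
    omega_eq_pow (Nat.mul_pos hk hl) hb'⟩

theorem greenH_omegaSucc [Finite S] (a : S) : GreenH (omegaSucc a) (omega a) := by
  obtain ⟨N, hN, ha, -, h, -⟩ := exists_common_pow a a
  obtain ⟨m, rfl⟩ : ∃ m, N = m + 1 := ⟨N - 1, by omega⟩
  rw [omegaSucc, h]
  refine ⟨⟨⟨a, rfl⟩, a ^ m, ?_⟩, ⟨a, (pow_mul_comm' a _).symm⟩, a ^ m, ?_⟩
  · rw [mul_assoc, ← pow_succ', ha]
  · rw [← pow_succ, ← pow_add, show m + (m + 1 + 1) = m + 1 + (m + 1) by omega, pow_add, ha]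

theorem pow_succ_mul_swap (u v : S) (k : ℕ) : u * (v * u) ^ k = (u * v) ^ k * u := by
  induction k with
  | zero => simp
  | succ k ih => rw [pow_succ, ← mul_assoc, ih, pow_succ]; simp only [mul_assoc]

theorem PrimaryConj.refl (a : S) : PrimaryConj a a := ⟨a, 1, by simp, by simp⟩

theorem PrimaryConj.symm {a b : S} : PrimaryConj a b → PrimaryConj b a :=
  fun ⟨u, v, h, h'⟩ => ⟨v, u, h', h⟩

theorem PrimaryConjStar.symm {a b : S} (h : PrimaryConjStar a b) : PrimaryConjStar b a := by
  induction h with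
  | single h => exact .single h.symm
  | tail _ h ih => exact .head h.symm ih

theorem PrimaryConj.omegaSucc [Finite S] {a b : S} (h : PrimaryConj a b) :
    PrimaryConj (omegaSucc a) (omegaSucc b) := by
  obtain ⟨u, v, rfl, rfl⟩ := h
  obtain ⟨N, -, -, -, h1, h2⟩ := exists_common_pow (u * v) (v * u)
  rw [SemigroupConj.omegaSucc, SemigroupConj.omegaSucc, h1, h2]
  refine ⟨(u * v) ^ N * u, v, by simp only [mul_assoc], ?_⟩
  rw [← mul_assoc, ← mul_assoc, pow_succ_mul_swap, mul_assoc]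

theorem PrimaryConj.traceConj [Finite S] {a b : S} (h : PrimaryConj a b) : TraceConj a b := by
  obtain ⟨u, v, rfl, rfl⟩ := h
  obtain ⟨N, hN, h1, h2, h3, h4⟩ := exists_common_pow (u * v) (v * u)
  obtain ⟨m, rfl⟩ : ∃ m, N = m + 1 := ⟨N - 1, by omega⟩
  have swap : ∀ k, v * (u * v) ^ k * u = (v * u) ^ (k + 1) := fun k => by
    rw [pow_succ_mul_swap, mul_assoc, pow_succ]
  have hgh : (u * v) ^ (m + 1) * u * (v * ((u * v) ^ m * (u * v) ^ (m + 1))) =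
      (u * v) ^ (m + 1) := by
    rw [mul_assoc, ← mul_assoc u, ← mul_assoc (u * v), ← pow_succ', h1, h1]
  have hhg : v * ((u * v) ^ m * (u * v) ^ (m + 1)) * ((u * v) ^ (m + 1) * u) =
      (v * u) ^ (m + 1) := by
    rw [← mul_assoc, mul_assoc v, mul_assoc _ _ ((u * v) ^ (m + 1)), h1, ← pow_add, swap,
      show m + (m + 1) + 1 = m + 1 + (m + 1) by omega, pow_add, h2]
  -- The exponent is `ω = m + 1`. In `h`, the factor `(u * v) ^ m` completes `u * v` to an
  -- idempotent power; the extra idempotent factor on the right is what makes `h * g * h = h`.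
  refine ⟨(u * v) ^ (m + 1) * u, v * ((u * v) ^ m * (u * v) ^ (m + 1)), ?_, ?_,
    by rw [hgh, h3], by rw [hhg, h4], ?_⟩
  · rw [hgh, ← mul_assoc, h1]
  · rw [mul_assoc, hgh, mul_assoc, mul_assoc, h1]
  · rw [SemigroupConj.omegaSucc, SemigroupConj.omegaSucc, h3, h4, ← pow_succ, mul_assoc v,
      ← mul_assoc, mul_assoc v, ← pow_add, ← pow_add, ← pow_add, swap, ← pow_succ,
      show m + (m + 1) + (m + 1 + 1) + (m + 1) + 1 = (m + 1) + (m + 1) + (m + 1) + (m + 1) + 1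
        by omega, pow_succ, pow_succ _ (m + 1), pow_add, pow_add, pow_add, h2, h2, h2]

/-- In a finite regular monoid every element is conjugate to its group part. -/
theorem primaryConjStar_omegaSucc [Finite S] (hS : ∀ a : S, ∃ x, a * x * a = a) (a : S) :
    PrimaryConjStar a (omegaSucc a) := by
  -- Induction on the size of the principal left ideal `S a`.
  induction hk : (Set.range fun s : S => s * a).ncard using Nat.strong_induction_on
    generalizing a with
  | _ k ih =>
  subst hk
  -- If `a ∈ S a²`, iterating gives `a = y ^ N * a ^ (N + 1)`, so `a` absorbs its idempotent power
  -- and equals its group part.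
  by_cases h : ∃ y, y * (a * a) = a
  · obtain ⟨y, hy⟩ := h
    have hy' : ∀ m : ℕ, y ^ m * a ^ (m + 1) = a := by
      intro m
      induction m with
      | zero => simp
      | succ m ih =>
        rw [pow_succ, pow_succ' a (m + 1), pow_succ' a m, ← mul_assoc a, mul_assoc (y ^ m),
          ← mul_assoc y, hy, ← pow_succ', ih]
    obtain ⟨N, -, h1, -, h2, -⟩ := exists_common_pow a a
    have : omegaSucc a = a := by
      rw [omegaSucc, h2, ← pow_succ, pow_succ']
      nth_rw 1 [← hy' N]
      rw [pow_succ', mul_assoc, mul_assoc, h1, ← pow_succ', hy']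
    rw [this]
    exact .single (.refl a)
  · obtain ⟨x, hx⟩ := hS a
    -- Regularity factors `a` as `a * (x * a)`. The swapped product generates a strictly smaller
    -- left ideal, since equality would put `a` in `S a²`.
    have hab : PrimaryConj a (x * a * a) := ⟨a, x * a, by rw [← mul_assoc, hx], rfl⟩
    refine (Relation.TransGen.head hab (ih _ ?_ _ rfl)).tail hab.omegaSucc.symm
    refine Set.ncard_lt_ncard ⟨?_, fun hle => ?_⟩ (Set.toFinite _)
    · rintro _ ⟨s, rfl⟩
      exact ⟨s * (x * a), by simp only [mul_assoc]⟩
    · obtain ⟨s, hs⟩ := hle ⟨1, rfl⟩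
      exact h ⟨s * x, by simpa only [mul_assoc, one_mul] using hs⟩

theorem TraceConj.primaryConjStar [Finite S] (hS : ∀ a : S, ∃ x, a * x * a = a) {a b : S}
    (h : TraceConj a b) : PrimaryConjStar a b := by
  obtain ⟨g, h, -, -, h3, -, h5⟩ := h
  refine ((primaryConjStar_omegaSucc hS a).tail ?_).trans (primaryConjStar_omegaSucc hS b).symm
  -- `g * h = omega a` acts as identity on the group part, so `omegaSucc a` splits as `g * (h *
  -- omegaSucc a)`.
  refine ⟨g, h * omegaSucc a, ?_, h5.symm⟩
  rw [← mul_assoc, h3, omegaSucc, ← mul_assoc, (isOmega_omega a).1.eq]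

end SemigroupConj

/-! ### Block structure of a product -/

namespace PartitionMonoid

variable {n : ℕ}

/-- The upper vertex `x` of `a` lies in a transversal block. -/
def Dom (a : PartitionMonoid n) (x : Fin n) : Prop := ∃ y, a.Rel (.inl x) (.inr y)

/-- The lower vertex `y'` of `a` lies in a transversal block. -/
def Cod (a : PartitionMonoid n) (y : Fin n) : Prop := ∃ x, a.Rel (.inl x) (.inr y)

theorem ker_iff {a : PartitionMonoid n} {x y} : a.ker x y ↔ a.Rel (.inl x) (.inl y) := Iff.rfl

theorem coker_iff {a : PartitionMonoid n} {x y} : a.coker x y ↔ a.Rel (.inr x) (.inr y) := Iff.rfl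

theorem coker_of_rel {a : PartitionMonoid n} {x y z} (h : a.Rel (.inl x) (.inr y))
    (h' : a.Rel (.inl x) (.inr z)) : a.coker y z := a.rel_trans (a.rel_symm h) h'

theorem ker_of_rel {a : PartitionMonoid n} {x y z} (h : a.Rel (.inl x) (.inr z))
    (h' : a.Rel (.inl y) (.inr z)) : a.ker x y := a.rel_trans h (a.rel_symm h')

theorem flip_ker (a : PartitionMonoid n) : a.flip.ker = a.coker := rfl

theorem flip_coker (a : PartitionMonoid n) : a.flip.coker = a.ker := rfl

theorem flip_inl_inr {a : PartitionMonoid n} {x y} :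
    a.flip.Rel (.inl x) (.inr y) ↔ a.Rel (.inl y) (.inr x) :=
  ⟨fun h => a.rel_symm h, fun h => a.rel_symm h⟩

theorem stackSetoid_middle {a b : PartitionMonoid n} {u v : Fin n}
    (h : (a.coker ⊔ b.ker) u v) : stackSetoid a b (.inr (.inl u)) (.inr (.inl v)) := by
  have : a.coker ⊔ b.ker ≤ Setoid.comap (fun u => .inr (.inl u)) (stackSetoid a b) :=
    sup_le (fun {_ _} h => stack_up (a := a) (b := b) h)
      (fun {_ _} h => stack_low (a := a) (b := b) h)
  exact this h

/-- The vertices of the stacked diagram that are connected to the top vertex `x`. -/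
def topComponent (a b : PartitionMonoid n) (x : Fin n) : Rows n → Prop
  | .inl y => a.Rel (.inl x) (.inl y) ∨
      ∃ u v, a.Rel (.inl x) (.inr u) ∧ (a.coker ⊔ b.ker) u v ∧ a.Rel (.inl y) (.inr v)
  | .inr (.inl v) => ∃ u, a.Rel (.inl x) (.inr u) ∧ (a.coker ⊔ b.ker) u v
  | .inr (.inr y) => ∃ u v, a.Rel (.inl x) (.inr u) ∧ (a.coker ⊔ b.ker) u v ∧
      b.Rel (.inl v) (.inr y)

theorem topComponent_up {a b : PartitionMonoid n} {x : Fin n} {p q} (h : a.Rel p q)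
    (hp : topComponent a b x (up p)) : topComponent a b x (up q) := by
  rcases p with p | p <;> rcases q with q | q
  · rcases hp with hp | ⟨u, v, h1, h2, h3⟩
    · exact .inl (a.rel_trans hp h)
    · exact .inr ⟨u, v, h1, h2, a.rel_trans (a.rel_symm h) h3⟩
  · rcases hp with hp | ⟨u, v, h1, h2, h3⟩
    · exact ⟨q, a.rel_trans hp h, Setoid.refl' _ _⟩
    · exact ⟨u, h1, Setoid.trans' _ h2 ((le_sup_left : a.coker ≤ _) (coker_of_rel h3 h))⟩
  · obtain ⟨u, h1, h2⟩ := hp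
    exact .inr ⟨u, p, h1, h2, a.rel_symm h⟩
  · obtain ⟨u, h1, h2⟩ := hp
    exact ⟨u, h1, Setoid.trans' _ h2 ((le_sup_left : a.coker ≤ _) h)⟩

theorem topComponent_low {a b : PartitionMonoid n} {x : Fin n} {p q} (h : b.Rel p q)
    (hp : topComponent a b x (low p)) : topComponent a b x (low q) := by
  rcases p with p | p <;> rcases q with q | q
  · obtain ⟨u, h1, h2⟩ := hp
    exact ⟨u, h1, Setoid.trans' _ h2 ((le_sup_right : b.ker ≤ _) h)⟩
  · obtain ⟨u, h1, h2⟩ := hp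
    exact ⟨u, p, h1, h2, h⟩
  · obtain ⟨u, v, h1, h2, h3⟩ := hp
    exact ⟨u, h1, Setoid.trans' _ h2 ((le_sup_right : b.ker ≤ _) (ker_of_rel h3 (b.rel_symm h)))⟩
  · obtain ⟨u, v, h1, h2, h3⟩ := hp
    exact ⟨u, v, h1, h2, b.rel_trans h3 h⟩

/-- The explicit set contains its starting vertex and is closed under the edges of both diagrams,
hence contains the whole component. -/
theorem topComponent_of_stack {a b : PartitionMonoid n} {x : Fin n} {r : Rows n}
    (h : stackSetoid a b (.inl x) r) : topComponent a b x r := by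
  -- The kernel of a predicate is the relation of having the same truth value, so invariance along
  -- edges becomes a bound on the generated equivalence.
  have : Setoid.ker (topComponent a b x) (.inl x) r := by
    refine stack_le (fun p q h => ?_) (fun p q h => ?_) h
    · exact propext ⟨topComponent_up h, topComponent_up (a.rel_symm h)⟩
    · exact propext ⟨topComponent_low h, topComponent_low (b.rel_symm h)⟩
  exact (iff_of_eq this).1 (.inl (a.rel_refl _))

theorem mul_inl_inl {a b : PartitionMonoid n} {x y : Fin n} :
    (a * b).Rel (.inl x) (.inl y) ↔ a.Rel (.inl x) (.inl y) ∨
      ∃ u v, a.Rel (.inl x) (.inr u) ∧ (a.coker ⊔ b.ker) u v ∧ a.Rel (.inl y) (.inr v) := by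
  refine ⟨fun h => topComponent_of_stack h, ?_⟩
  rintro (h | ⟨u, v, h1, h2, h3⟩)
  · exact stack_up (b := b) h
  · exact Setoid.trans' (stackSetoid a b) (stack_up (b := b) h1)
      (Setoid.trans' _ (stackSetoid_middle h2) (Setoid.symm' _ (stack_up (b := b) h3)))

/-- However often a path from top to bottom turns back, all its middle vertices lie in one class of
`a.coker ⊔ b.ker`, so one entry and one exit suffice. -/
theorem mul_inl_inr {a b : PartitionMonoid n} {x y : Fin n} :
    (a * b).Rel (.inl x) (.inr y) ↔
      ∃ u v, a.Rel (.inl x) (.inr u) ∧ (a.coker ⊔ b.ker) u v ∧ b.Rel (.inl v) (.inr y) := by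
  refine ⟨fun h => topComponent_of_stack h, ?_⟩
  rintro ⟨u, v, h1, h2, h3⟩
  exact Setoid.trans' (stackSetoid a b) (stack_up (b := b) h1)
    (Setoid.trans' _ (stackSetoid_middle h2) (stack_low (a := a) h3))

theorem mul_inr_inr {a b : PartitionMonoid n} {x y : Fin n} :
    (a * b).Rel (.inr x) (.inr y) ↔ b.Rel (.inr x) (.inr y) ∨
      ∃ u v, b.Rel (.inl u) (.inr x) ∧ (a.coker ⊔ b.ker) u v ∧ b.Rel (.inl v) (.inr y) := by
  have h : (a * b).Rel (.inr x) (.inr y) ↔ (b.flip * a.flip).Rel (.inl x) (.inl y) := by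
    rw [← flip_mul]; rfl
  rw [h, mul_inl_inl, flip_ker, flip_coker, sup_comm]
  simp only [flip_inl_inr]
  rfl

/-- Partitions are determined by their kernels, cokernels and transversal blocks. -/
theorem ext_of_rows {a b : PartitionMonoid n}
    (h1 : ∀ x y, a.Rel (.inl x) (.inl y) ↔ b.Rel (.inl x) (.inl y))
    (h2 : ∀ x y, a.Rel (.inr x) (.inr y) ↔ b.Rel (.inr x) (.inr y))
    (h3 : ∀ x y, a.Rel (.inl x) (.inr y) ↔ b.Rel (.inl x) (.inr y)) : a = b := by
  refine ext_rel ?_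
  rintro (x | x) (y | y)
  · exact h1 x y
  · exact h3 x y
  · exact ⟨fun h => b.rel_symm ((h3 y x).1 (a.rel_symm h)),
      fun h => a.rel_symm ((h3 y x).2 (b.rel_symm h))⟩
  · exact h2 x y

/-- The partition monoid is a regular `*`-monoid. -/
theorem mul_flip_mul (a : PartitionMonoid n) : a * a.flip * a = a := by
  have hk : ∀ {s : Setoid (Fin n)} {u v}, (s ⊔ s) u v → s u v := fun h => by
    rwa [sup_idem] at h
  rw [mul_assoc]
  -- The product `a.flip * a` is a symmetric projection: both its kernel and its cokernel are the
  -- cokernel of `a`, and each lower part of a transversal block of `a` is joined to its own copy.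
  have hker : (a.flip * a).ker = a.coker := by
    ext x y
    rw [ker_iff, mul_inl_inl]
    refine ⟨?_, .inl⟩
    rintro (h | ⟨u, v, h1, h2, h3⟩)
    · exact h
    · exact coker_of_rel (a.rel_trans (flip_inl_inr.1 h1) (a.rel_refl _))
        (a.rel_trans (hk h2) (flip_inl_inr.1 h3))
  have htr : ∀ x y, (a.flip * a).Rel (.inl x) (.inr y) ↔ a.coker x y ∧ a.Cod x := by
    intro x y
    rw [mul_inl_inr]
    constructor
    · rintro ⟨u, v, h1, h2, h3⟩
      exact ⟨coker_of_rel (flip_inl_inr.1 h1) (a.rel_trans (hk h2) h3),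
        u, flip_inl_inr.1 h1⟩
    · rintro ⟨h, u, hu⟩
      exact ⟨u, u, flip_inl_inr.2 hu, Setoid.refl' _ _, a.rel_trans hu h⟩
  have hco : (a.flip * a).coker = a.coker := by
    ext x y
    rw [coker_iff, mul_inr_inr]
    refine ⟨?_, .inl⟩
    rintro (h | ⟨u, v, h1, h2, h3⟩)
    · exact h
    · exact coker_of_rel h1 (a.rel_trans (hk h2) h3)
  refine ext_of_rows (fun x y => ?_) (fun x y => ?_) (fun x y => ?_)
  · rw [mul_inl_inl, hker]
    refine ⟨?_, .inl⟩
    rintro (h | ⟨u, v, h1, h2, h3⟩)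
    · exact h
    · exact ker_of_rel (a.rel_trans h1 (hk h2)) h3
  · rw [mul_inr_inr, ← coker_iff, hco, hker]
    refine ⟨?_, .inl⟩
    rintro (h | ⟨u, v, h1, h2, h3⟩)
    · exact h
    · exact a.rel_trans (a.rel_symm ((htr _ _).1 h1).1)
        (a.rel_trans (hk h2) ((htr _ _).1 h3).1)
  · rw [mul_inl_inr, hker]
    constructor
    · rintro ⟨u, v, h1, h2, h3⟩
      exact a.rel_trans h1 (a.rel_trans (hk h2) ((htr _ _).1 h3).1)
    · intro h
      exact ⟨y, y, h, Setoid.refl' _ _, (htr _ _).2 ⟨a.rel_refl _, x, h⟩⟩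

end PartitionMonoid

/-! ### Group elements and partitions with prescribed rows -/

namespace PartitionMonoid

variable {n : ℕ}

/-- `z` has the kernel of `c`, and the same upper parts of transversal blocks. -/
structure UpperEq (z c : PartitionMonoid n) : Prop where
  ker_iff : ∀ x y, z.Rel (.inl x) (.inl y) ↔ c.Rel (.inl x) (.inl y)
  dom_iff : ∀ x, z.Dom x ↔ c.Dom x

/-- `z` has the cokernel of `d`, and the same lower parts of transversal blocks. -/
structure LowerEq (z d : PartitionMonoid n) : Prop where
  coker_iff : ∀ x y, z.Rel (.inr x) (.inr y) ↔ d.Rel (.inr x) (.inr y)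
  cod_iff : ∀ y, z.Cod y ↔ d.Cod y

theorem UpperEq.refl (c : PartitionMonoid n) : UpperEq c c := ⟨fun _ _ => Iff.rfl, fun _ => Iff.rfl⟩

theorem LowerEq.refl (c : PartitionMonoid n) : LowerEq c c := ⟨fun _ _ => Iff.rfl, fun _ => Iff.rfl⟩

theorem UpperEq.symm {z c : PartitionMonoid n} (h : UpperEq z c) : UpperEq c z :=
  ⟨fun x y => (h.1 x y).symm, fun x => (h.2 x).symm⟩

theorem LowerEq.symm {z c : PartitionMonoid n} (h : LowerEq z c) : LowerEq c z :=
  ⟨fun x y => (h.1 x y).symm, fun x => (h.2 x).symm⟩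

theorem UpperEq.trans {a b c : PartitionMonoid n} (h : UpperEq a b) (h' : UpperEq b c) :
    UpperEq a c := ⟨fun x y => (h.1 x y).trans (h'.1 x y), fun x => (h.2 x).trans (h'.2 x)⟩

theorem LowerEq.trans {a b c : PartitionMonoid n} (h : LowerEq a b) (h' : LowerEq b c) :
    LowerEq a c := ⟨fun x y => (h.1 x y).trans (h'.1 x y), fun x => (h.2 x).trans (h'.2 x)⟩

theorem UpperEq.ker_eq {z c : PartitionMonoid n} (h : UpperEq z c) : z.ker = c.ker :=
  Setoid.ext h.1

theorem LowerEq.coker_eq {z c : PartitionMonoid n} (h : LowerEq z c) : z.coker = c.coker :=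
  Setoid.ext h.1

/-- Right multiplication can only enlarge the kernel and shrink the set of upper vertices in
transversal blocks. Elements that are right multiples of each other therefore agree in both. -/
theorem upperEq_of_greenR {a b : PartitionMonoid n} (h : SemigroupConj.GreenR a b) :
    UpperEq a b := by
  obtain ⟨⟨r, hr⟩, s, hs⟩ := h
  have key : ∀ c r : PartitionMonoid n, ∀ x, (c * r).Dom x → c.Dom x := by
    rintro c r x ⟨y, hy⟩
    obtain ⟨u, v, h1, -⟩ := mul_inl_inr.1 hy
    exact ⟨u, h1⟩
  refine ⟨fun x y => ⟨fun h => ?_, fun h => ?_⟩, fun x => ⟨fun h => ?_, fun h => ?_⟩⟩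
  · rw [← hs]; exact mul_inl_inl.2 (.inl h)
  · rw [← hr]; exact mul_inl_inl.2 (.inl h)
  · rw [← hr] at h; exact key _ _ _ h
  · rw [← hs] at h; exact key _ _ _ h

theorem lowerEq_of_greenL {a b : PartitionMonoid n} (h : SemigroupConj.GreenL a b) :
    LowerEq a b := by
  obtain ⟨⟨r, hr⟩, s, hs⟩ := h
  have key : ∀ c r : PartitionMonoid n, ∀ x, (r * c).Cod x → c.Cod x := by
    rintro c r x ⟨y, hy⟩
    obtain ⟨u, v, -, -, h1⟩ := mul_inl_inr.1 hy
    exact ⟨v, h1⟩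
  refine ⟨fun x y => ⟨fun h => ?_, fun h => ?_⟩, fun x => ⟨fun h => ?_, fun h => ?_⟩⟩
  · rw [← hs]; exact mul_inr_inr.2 (.inl h)
  · rw [← hr]; exact mul_inr_inr.2 (.inl h)
  · rw [← hr] at h; exact key _ _ _ h
  · rw [← hs] at h; exact key _ _ _ h

/-- Each class of the join of the kernel and the cokernel contains at most one upper and at most
one lower part of a transversal block, and contains one if and only if it contains the other. -/
structure IsGroupLike (c : PartitionMonoid n) : Prop where
  ker_of_dom : ∀ {x y}, c.Dom x → c.Dom y → (c.ker ⊔ c.coker) x y → c.Rel (.inl x) (.inl y)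
  coker_of_cod : ∀ {x y}, c.Cod x → c.Cod y → (c.ker ⊔ c.coker) x y → c.Rel (.inr x) (.inr y)
  exists_cod : ∀ {x}, c.Dom x → ∃ y, c.Cod y ∧ (c.ker ⊔ c.coker) x y
  exists_dom : ∀ {y}, c.Cod y → ∃ x, c.Dom x ∧ (c.ker ⊔ c.coker) x y

/-- The condition mentions rows only, so it spreads from an idempotent to its `H`-class. -/
theorem IsGroupLike.of_eq {c e : PartitionMonoid n} (he : IsGroupLike e) (h1 : UpperEq c e)
    (h2 : LowerEq c e) : IsGroupLike c where
  ker_of_dom {x y} hx hy h := by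
    rw [h1.ker_eq, h2.coker_eq] at h
    exact (h1.1 _ _).2 (he.ker_of_dom ((h1.2 _).1 hx) ((h1.2 _).1 hy) h)
  coker_of_cod {x y} hx hy h := by
    rw [h1.ker_eq, h2.coker_eq] at h
    exact (h2.1 _ _).2 (he.coker_of_cod ((h2.2 _).1 hx) ((h2.2 _).1 hy) h)
  exists_cod {x} hx := by
    obtain ⟨y, hy, h⟩ := he.exists_cod ((h1.2 _).1 hx)
    rw [h1.ker_eq, h2.coker_eq]
    exact ⟨y, (h2.2 _).2 hy, h⟩
  exists_dom {x} hx := by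
    obtain ⟨y, hy, h⟩ := he.exists_dom ((h2.2 _).1 hx)
    rw [h1.ker_eq, h2.coker_eq]
    exact ⟨y, (h1.2 _).2 hy, h⟩

/-! ### Idempotent partitions -/

section Idempotent

variable {e : PartitionMonoid n}

theorem rel_of_idem (he : e * e = e) {x y u v} (h1 : e.Rel (.inl x) (.inr u))
    (h2 : (e.ker ⊔ e.coker) u v) (h3 : e.Rel (.inl v) (.inr y)) : e.Rel (.inl x) (.inr y) := by
  rw [← he, mul_inl_inr, sup_comm]
  exact ⟨u, v, h1, h2, h3⟩

/-- A block of `e` from `x` to `y` is also a path through `e * e`. That path leaves the middle row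
from a vertex kernel-equivalent to `x` and enters it at one cokernel-equivalent to `y`, and these
two are joined. -/
theorem join_of_idem (he : e * e = e) {x y} (h : e.Rel (.inl x) (.inr y)) :
    (e.ker ⊔ e.coker) x y := by
  have h' := h
  rw [← he, mul_inl_inr, sup_comm] at h'
  obtain ⟨u, v, h1, h2, h3⟩ := h'
  have h4 : (e.ker ⊔ e.coker) x v := (le_sup_left : e.ker ≤ _) (ker_of_rel h h3)
  have h5 : (e.ker ⊔ e.coker) u y := (le_sup_right : e.coker ≤ _) (coker_of_rel h1 h)
  exact Setoid.trans' _ h4 (Setoid.trans' _ (Setoid.symm' _ h2) h5)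

/-- An idempotent is recovered from its rows: its transversal blocks pair the upper and lower parts
lying in a common join class. -/
theorem rel_iff_of_idem (he : e * e = e) {x y} :
    e.Rel (.inl x) (.inr y) ↔ e.Dom x ∧ e.Cod y ∧ (e.ker ⊔ e.coker) x y := by
  refine ⟨fun h => ⟨⟨y, h⟩, ⟨x, h⟩, join_of_idem he h⟩, ?_⟩
  rintro ⟨⟨u, hu⟩, ⟨v, hv⟩, h⟩
  exact rel_of_idem he hu (Setoid.trans' _ (Setoid.symm' _ (join_of_idem he hu))
    (Setoid.trans' _ h (Setoid.symm' _ (join_of_idem he hv)))) hv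

theorem isGroupLike_of_idem (he : e * e = e) : IsGroupLike e where
  ker_of_dom {x y} hx hy h := by
    obtain ⟨u, hu⟩ := hy
    exact ker_of_rel ((rel_iff_of_idem he).2
      ⟨hx, ⟨y, hu⟩, Setoid.trans' _ h (join_of_idem he hu)⟩) hu
  coker_of_cod {x y} hx hy h := by
    obtain ⟨u, hu⟩ := hx
    exact coker_of_rel hu ((rel_iff_of_idem he).2
      ⟨⟨x, hu⟩, hy, Setoid.trans' _ (join_of_idem he hu) h⟩)
  exists_cod {x} := fun ⟨y, h⟩ => ⟨y, ⟨x, h⟩, join_of_idem he h⟩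
  exists_dom {y} := fun ⟨x, h⟩ => ⟨x, ⟨y, h⟩, join_of_idem he h⟩

end Idempotent

/-- The class of `x` in the join of the kernel and the cokernel of `c`. -/
def joinClass (c : PartitionMonoid n) (x : Fin n) : Quotient (c.ker ⊔ c.coker) := Quotient.mk _ x

theorem joinClass_eq {c : PartitionMonoid n} {x y} :
    c.joinClass x = c.joinClass y ↔ (c.ker ⊔ c.coker) x y := Quotient.eq

theorem exists_dom_mem {c : PartitionMonoid n} (P : TransversalClass c) :
    ∃ x, c.Dom x ∧ c.joinClass x = P.1 := by
  obtain ⟨x, y, h1, h2⟩ := P.2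
  exact ⟨x, ⟨y, h2⟩, h1⟩

theorem IsGroupLike.exists_cod_mem {c : PartitionMonoid n} (hc : IsGroupLike c)
    (P : TransversalClass c) : ∃ y, c.Cod y ∧ c.joinClass y = P.1 := by
  obtain ⟨x, hx, h⟩ := exists_dom_mem P
  obtain ⟨y, hy, h'⟩ := hc.exists_cod hx
  exact ⟨y, hy, (joinClass_eq.2 h').symm.trans h⟩

theorem exists_class_of_dom {c : PartitionMonoid n} {x} (h : c.Dom x) :
    ∃ P : TransversalClass c, c.joinClass x = P.1 :=
  ⟨⟨c.joinClass x, x, h.choose, rfl, h.choose_spec⟩, rfl⟩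

theorem IsGroupLike.exists_class_of_cod {c : PartitionMonoid n} (hc : IsGroupLike c) {y}
    (h : c.Cod y) : ∃ P : TransversalClass c, c.joinClass y = P.1 := by
  obtain ⟨x, hx, h'⟩ := hc.exists_dom h
  obtain ⟨P, hP⟩ := exists_class_of_dom hx
  exact ⟨P, (joinClass_eq.2 h').symm.trans hP⟩

/-- `z` has the upper row of `c`, the lower row of `d`, and its transversal blocks connect them
as prescribed by `φ`. -/
structure Realizes (c d : PartitionMonoid n) (φ : TransversalClass c ≃ TransversalClass d)
    (z : PartitionMonoid n) : Prop where
  upper : UpperEq z c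
  lower : LowerEq z d
  rel_iff : ∀ x y, z.Rel (.inl x) (.inr y) ↔ c.Dom x ∧ d.Cod y ∧
    ∃ P, c.joinClass x = P.1 ∧ d.joinClass y = (φ P).1

theorem Realizes.eq {c d z w : PartitionMonoid n} {φ : TransversalClass c ≃ TransversalClass d}
    (hz : Realizes c d φ z) (hw : Realizes c d φ w) : z = w :=
  ext_of_rows (fun x y => (hz.upper.1 x y).trans (hw.upper.1 x y).symm)
    (fun x y => (hz.lower.1 x y).trans (hw.lower.1 x y).symm)
    (fun x y => (hz.rel_iff x y).trans (hw.rel_iff x y).symm)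

theorem Realizes.unique {c d z : PartitionMonoid n} {φ ψ : TransversalClass c ≃ TransversalClass d}
    (hd : IsGroupLike d) (hφ : Realizes c d φ z) (hψ : Realizes c d ψ z) : φ = ψ := by
  ext1 P
  obtain ⟨x, hx, h⟩ := exists_dom_mem P
  obtain ⟨y, hy, h'⟩ := hd.exists_cod_mem (φ P)
  obtain ⟨-, -, Q, hQ, hQ'⟩ := (hψ.rel_iff x y).1 ((hφ.rel_iff x y).2 ⟨hx, hy, P, h, h'⟩)
  obtain rfl : P = Q := Subtype.ext (h.symm.trans hQ)
  exact Subtype.ext (h'.symm.trans hQ')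

/-- In the dictionary between partitions and bijections, idempotents are the identities. -/
theorem realizes_one_of_idem {c e : PartitionMonoid n} (he : e * e = e) (h1 : UpperEq e c)
    (h2 : LowerEq e c) : Realizes c c (Equiv.refl _) e := by
  refine ⟨h1, h2, fun x y => ?_⟩
  rw [rel_iff_of_idem he, h1.2, h2.2, h1.ker_eq, h2.coker_eq, ← joinClass_eq]
  refine and_congr_right fun hx => and_congr_right fun hy => ⟨fun h => ?_, ?_⟩
  · obtain ⟨P, hP⟩ := exists_class_of_dom hx
    exact ⟨P, hP, h.symm.trans hP⟩
  · rintro ⟨P, hP, hP'⟩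
    exact hP.trans hP'.symm

/-- The middle row is partitioned by the join for `d`. Each of its transversal classes receives one
block of `z` and emits one block of `w`, so blocks are concatenated without merging or dying. -/
theorem Realizes.mul {c d k z w : PartitionMonoid n}
    {φ : TransversalClass c ≃ TransversalClass d} {ψ : TransversalClass d ≃ TransversalClass k}
    (hc : IsGroupLike c) (hd : IsGroupLike d) (hk : IsGroupLike k)
    (hz : Realizes c d φ z) (hw : Realizes d k ψ w) : Realizes c k (φ.trans ψ) (z * w) := by
  have hj : z.coker ⊔ w.ker = d.ker ⊔ d.coker := by
    rw [hz.lower.coker_eq, hw.upper.ker_eq, sup_comm]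
  have rel : ∀ x y, (z * w).Rel (.inl x) (.inr y) ↔ c.Dom x ∧ k.Cod y ∧
      ∃ P, c.joinClass x = P.1 ∧ k.joinClass y = (φ.trans ψ P).1 := by
    intro x y
    rw [mul_inl_inr, hj]
    constructor
    · rintro ⟨u, v, h1, h2, h3⟩
      obtain ⟨hx, hu, P, hP, hP'⟩ := (hz.rel_iff x u).1 h1
      obtain ⟨hv, hy, Q, hQ, hQ'⟩ := (hw.rel_iff v y).1 h3
      obtain rfl : φ P = Q := Subtype.ext (hP'.symm.trans ((joinClass_eq.2 h2).trans hQ))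
      exact ⟨hx, hy, P, hP, hQ'⟩
    · rintro ⟨hx, hy, P, hP, hQ⟩
      obtain ⟨u, hu, h⟩ := hd.exists_cod_mem (φ P)
      obtain ⟨v, hv, h'⟩ := exists_dom_mem (φ P)
      exact ⟨u, v, (hz.rel_iff x u).2 ⟨hx, hu, P, hP, h⟩, joinClass_eq.1 (h.trans h'.symm),
        (hw.rel_iff v y).2 ⟨hv, hy, _, h', hQ⟩⟩
  refine ⟨⟨fun x y => ?_, fun x => ?_⟩, ⟨fun x y => ?_, fun y => ?_⟩, rel⟩
  · rw [mul_inl_inl, hj, hz.upper.1]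
    refine ⟨?_, .inl⟩
    rintro (h | ⟨u, v, h1, h2, h3⟩)
    · exact h
    · obtain ⟨hx, hu, P, hP, hP'⟩ := (hz.rel_iff x u).1 h1
      obtain ⟨hy, hv, Q, hQ, hQ'⟩ := (hz.rel_iff y v).1 h3
      obtain rfl : P = Q := φ.injective
        (Subtype.ext (hP'.symm.trans ((joinClass_eq.2 h2).trans hQ')))
      exact hc.ker_of_dom hx hy (joinClass_eq.1 (hP.trans hQ.symm))
  · refine ⟨fun ⟨y, h⟩ => ((rel x y).1 h).1, fun h => ?_⟩
    obtain ⟨P, hP⟩ := exists_class_of_dom h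
    obtain ⟨y, hy, hQ⟩ := hk.exists_cod_mem (φ.trans ψ P)
    exact ⟨y, (rel x y).2 ⟨h, hy, P, hP, hQ⟩⟩
  · rw [mul_inr_inr, hj, hw.lower.1]
    refine ⟨?_, .inl⟩
    rintro (h | ⟨u, v, h1, h2, h3⟩)
    · exact h
    · obtain ⟨hu, hx, P, hP, hP'⟩ := (hw.rel_iff u x).1 h1
      obtain ⟨hv, hy, Q, hQ, hQ'⟩ := (hw.rel_iff v y).1 h3
      obtain rfl : P = Q := Subtype.ext (hP.symm.trans ((joinClass_eq.2 h2).trans hQ))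
      exact hk.coker_of_cod hx hy (joinClass_eq.1 (hP'.trans hQ'.symm))
  · refine ⟨fun ⟨x, h⟩ => ((rel x y).1 h).2.1, fun h => ?_⟩
    obtain ⟨P, hP⟩ := hk.exists_class_of_cod h
    obtain ⟨x, hx, hQ⟩ := exists_dom_mem ((φ.trans ψ).symm P)
    exact ⟨x, (rel x y).2 ⟨hx, h, _, hQ, by rw [hP, Equiv.apply_symm_apply]⟩⟩

/-- A transversal class of `c` holds a single upper part, and one of `d` a single lower part. The
transversal blocks of `z` match these parts, which gives a bijection of classes. -/
theorem exists_realizes_of_rows {c d z : PartitionMonoid n} (hc : IsGroupLike c)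
    (hd : IsGroupLike d) (h1 : UpperEq z c) (h2 : LowerEq z d) : ∃ φ, Realizes c d φ z := by
  have tot : ∀ P : TransversalClass c, ∃ Q : TransversalClass d, ∃ x y,
      c.joinClass x = P.1 ∧ d.joinClass y = Q.1 ∧ z.Rel (.inl x) (.inr y) := by
    intro P
    obtain ⟨x, hx, h⟩ := exists_dom_mem P
    obtain ⟨y, hy⟩ := (h1.2 x).2 hx
    obtain ⟨Q, hQ⟩ := hd.exists_class_of_cod ((h2.2 y).1 ⟨x, hy⟩)
    exact ⟨Q, x, y, h, hQ, hy⟩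
  have left : ∀ {x y x' y'}, z.Rel (.inl x) (.inr y) → z.Rel (.inl x') (.inr y') →
      c.joinClass x = c.joinClass x' → z.Rel (.inl x) (.inl x') := fun h h' e =>
    (h1.1 _ _).2 (hc.ker_of_dom ((h1.2 _).1 ⟨_, h⟩) ((h1.2 _).1 ⟨_, h'⟩) (joinClass_eq.1 e))
  have right : ∀ {x y x' y'}, z.Rel (.inl x) (.inr y) → z.Rel (.inl x') (.inr y') →
      d.joinClass y = d.joinClass y' → z.Rel (.inr y) (.inr y') := fun h h' e =>
    (h2.1 _ _).2 (hd.coker_of_cod ((h2.2 _).1 ⟨_, h⟩) ((h2.2 _).1 ⟨_, h'⟩) (joinClass_eq.1 e))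
  choose f X Y hX hY hR using tot
  have inj : Function.Injective f := by
    intro P Q h
    have h' := right (hR P) (hR Q) (by rw [hY, hY, h])
    have h'' := z.rel_trans (hR P) (z.rel_trans h' (z.rel_symm (hR Q)))
    refine Subtype.ext ?_
    rw [← hX P, ← hX Q, joinClass_eq]
    exact (le_sup_left : c.ker ≤ _) ((h1.1 _ _).1 h'')
  have surj : Function.Surjective f := by
    intro Q
    obtain ⟨y, hy, h⟩ := hd.exists_cod_mem Q
    obtain ⟨x, hx⟩ := (h2.2 y).2 hy
    obtain ⟨P, hP⟩ := exists_class_of_dom ((h1.2 x).1 ⟨y, hx⟩)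
    refine ⟨P, Subtype.ext ?_⟩
    have h' := left (hR P) hx (by rw [hX, hP])
    have h'' := z.rel_trans (z.rel_symm (hR P)) (z.rel_trans h' hx)
    rw [← hY P, ← h, joinClass_eq]
    exact (le_sup_right : d.coker ≤ _) ((h2.1 _ _).1 h'')
  have bij : Function.Bijective f := ⟨inj, surj⟩
  refine ⟨Equiv.ofBijective f bij, h1, h2, fun x y => ⟨fun h => ?_, ?_⟩⟩
  · have hx := (h1.2 x).1 ⟨y, h⟩
    obtain ⟨P, hP⟩ := exists_class_of_dom hx
    refine ⟨hx, (h2.2 y).1 ⟨x, h⟩, P, hP, ?_⟩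
    have h' := left (hR P) h (by rw [hX, hP])
    have h'' := z.rel_trans (z.rel_symm (hR P)) (z.rel_trans h' h)
    rw [Equiv.ofBijective_apply, ← hY P, joinClass_eq]
    exact Setoid.symm' _ ((le_sup_right : d.coker ≤ _) ((h2.1 _ _).1 h''))
  · rintro ⟨hx, hy, P, hP, hQ⟩
    rw [Equiv.ofBijective_apply] at hQ
    obtain ⟨y', hy'⟩ := (h1.2 x).2 hx
    obtain ⟨x', hx'⟩ := (h2.2 y).2 hy
    exact z.rel_trans (left hy' (hR P) (by rw [hX, hP])) (z.rel_trans (hR P)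
      (right (hR P) hx' (by rw [hY, hQ])))

/-- The partition with kernel `s`, cokernel `t`, and transversal blocks given by `M`. -/
def ofRows (s t : Setoid (Fin n)) (M : Fin n → Fin n → Prop)
    (hs : ∀ {x x' y}, s x x' → M x' y → M x y) (ht : ∀ {x y y'}, t y y' → M x y' → M x y)
    (hs' : ∀ {x x' y}, M x y → M x' y → s x x') (ht' : ∀ {x y y'}, M x y → M x y' → t y y') :
    PartitionMonoid n where
  r
    | .inl x, .inl y => s x y
    | .inl x, .inr y => M x y
    | .inr x, .inl y => M y x
    | .inr x, .inr y => t x y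
  iseqv :=
    { refl := by
        rintro (x | x)
        · exact Setoid.refl' s x
        · exact Setoid.refl' t x
      symm := by
        rintro (x | x) (y | y) h
        · exact Setoid.symm' s h
        · exact h
        · exact h
        · exact Setoid.symm' t h
      trans := by
        rintro (x | x) (y | y) (z | z) h h'
        · exact Setoid.trans' s h h'
        · exact hs h h'
        · exact hs' h h'
        · exact ht (Setoid.symm' t h') h
        · exact hs (Setoid.symm' s h') h
        · exact ht' h h'
        · exact ht h h'
        · exact Setoid.trans' t h h' }

theorem exists_realizes {c d : PartitionMonoid n} (hc : IsGroupLike c) (hd : IsGroupLike d)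
    (φ : TransversalClass c ≃ TransversalClass d) : ∃ z, Realizes c d φ z := by
  have dom : ∀ {x x'}, c.ker x x' → c.Dom x' → c.Dom x := fun h ⟨y, hy⟩ => ⟨y, c.rel_trans h hy⟩
  have cod : ∀ {y y'}, d.coker y y' → d.Cod y' → d.Cod y := fun h ⟨x, hx⟩ =>
    ⟨x, d.rel_trans hx (d.rel_symm h)⟩
  let M : Fin n → Fin n → Prop := fun x y => c.Dom x ∧ d.Cod y ∧
    ∃ P, c.joinClass x = P.1 ∧ d.joinClass y = (φ P).1
  refine ⟨ofRows c.ker d.coker M ?_ ?_ ?_ ?_, ⟨fun x y => Iff.rfl, fun x => ⟨?_, fun h => ?_⟩⟩,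
    ⟨fun x y => Iff.rfl, fun y => ⟨?_, fun h => ?_⟩⟩, fun x y => Iff.rfl⟩
  · rintro x x' y h ⟨hx, hy, P, hP, hQ⟩
    exact ⟨dom h hx, hy, P, (joinClass_eq.2 ((le_sup_left : c.ker ≤ _) h)).trans hP, hQ⟩
  · rintro x y y' h ⟨hx, hy, P, hP, hQ⟩
    exact ⟨hx, cod h hy, P, hP, (joinClass_eq.2 ((le_sup_right : d.coker ≤ _) h)).trans hQ⟩
  · rintro x x' y ⟨hx, hy, P, hP, hQ⟩ ⟨hx', -, P', hP', hQ'⟩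
    obtain rfl : P = P' := φ.injective (Subtype.ext (hQ.symm.trans hQ'))
    exact hc.ker_of_dom hx hx' (joinClass_eq.1 (hP.trans hP'.symm))
  · rintro x y y' ⟨hx, hy, P, hP, hQ⟩ ⟨-, hy', P', hP', hQ'⟩
    obtain rfl : P = P' := Subtype.ext (hP.symm.trans hP')
    exact hd.coker_of_cod hy hy' (joinClass_eq.1 (hQ.trans hQ'.symm))
  · rintro ⟨y, h⟩
    exact h.1
  · obtain ⟨P, hP⟩ := exists_class_of_dom h
    obtain ⟨y, hy, hQ⟩ := hd.exists_cod_mem (φ P)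
    exact ⟨y, h, hy, P, hP, hQ⟩
  · rintro ⟨y, h⟩
    exact h.2.1
  · obtain ⟨P, hP⟩ := hd.exists_class_of_cod h
    obtain ⟨x, hx, hQ⟩ := exists_dom_mem (φ.symm P)
    exact ⟨x, hx, h, _, hQ, by rw [hP, Equiv.apply_symm_apply]⟩

end PartitionMonoid

/-! ### Cycle types and conjugacy -/

theorem Equiv.Perm.parts_partition_permCongr {α β : Type*} [Fintype α] [DecidableEq α] [Fintype β]
    [DecidableEq β] (φ : α ≃ β) (τ : Equiv.Perm α) :
    (φ.permCongr τ).partition.parts = τ.partition.parts := by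
  have h : (φ.permCongr τ).cycleType = τ.cycleType := by
    -- Relabelling along `φ` is extension to a subset that is everything, so no points are added
    -- outside it.
    have := Equiv.Perm.cycleType_extendDomain (φ.trans (Equiv.Set.univ β).symm) (g := τ)
    rw [← this]
    congr 1
  rw [Equiv.Perm.parts_partition, Equiv.Perm.parts_partition, h, ← Equiv.Perm.sum_cycleType,
    ← Equiv.Perm.sum_cycleType, h, Fintype.card_congr φ]

/-- Equal parts have equal sums, so the two sets are equinumerous. After an arbitrary
identification, permutations of one set with the same partition are conjugate. -/
theorem Equiv.Perm.exists_permCongr_eq {α β : Type*} [Fintype α] [DecidableEq α] [Fintype β]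
    [DecidableEq β] {τ : Equiv.Perm α} {σ : Equiv.Perm β}
    (h : τ.partition.parts = σ.partition.parts) : ∃ φ : α ≃ β, φ.permCongr τ = σ := by
  have hcard : Fintype.card α = Fintype.card β := by
    rw [← τ.partition.parts_sum, ← σ.partition.parts_sum, h]
  let φ := Fintype.equivOfCardEq hcard
  obtain ⟨π, hπ⟩ := isConj_iff.1 (Equiv.Perm.partition_eq_of_isConj.2
    (Nat.Partition.ext ((Equiv.Perm.parts_partition_permCongr φ τ).trans h)))
  refine ⟨φ.trans π, ?_⟩
  rw [← hπ]
  ext x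
  simp [Equiv.permCongr_apply]

namespace PartitionMonoid

variable {n : ℕ}

theorem IsTransversalPerm.unique {c : PartitionMonoid n} {σ τ : Equiv.Perm (TransversalClass c)}
    (hσ : IsTransversalPerm c σ) (hτ : IsTransversalPerm c τ) : σ = τ :=
  Equiv.ext fun P => (hσ P _).2 ((hτ P _).1 rfl)

/-- Identifies the bijection attached to `c` by its own rows with the permutation that defines the
cycle type. -/
theorem Realizes.isTransversalPerm {c : PartitionMonoid n} {τ : Equiv.Perm (TransversalClass c)}
    (hc : IsGroupLike c) (h : Realizes c c τ c) : IsTransversalPerm c τ := by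
  intro P Q
  constructor
  · rintro rfl
    obtain ⟨x, hx, hP⟩ := exists_dom_mem P
    obtain ⟨y, hy, hQ⟩ := hc.exists_cod_mem (τ P)
    exact ⟨x, y, hP, hQ, (h.rel_iff x y).2 ⟨hx, hy, P, hP, hQ⟩⟩
  · rintro ⟨x, y, hx, hy, hxy⟩
    obtain ⟨-, -, P', hP, hQ⟩ := (h.rel_iff x y).1 hxy
    obtain rfl : P' = P := Subtype.ext (hP.symm.trans hx)
    exact Subtype.ext (hQ.symm.trans hy)

theorem HasCycleType.unique {c : PartitionMonoid n} {μ ν : Multiset ℕ} (h : HasCycleType c μ)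
    (h' : HasCycleType c ν) : μ = ν := by
  obtain ⟨-, τ, h1, rfl⟩ := h
  obtain ⟨-, σ, h2, rfl⟩ := h'
  rw [h1.unique h2]

theorem SameCycleType.trans {a b c : PartitionMonoid n} (h : SameCycleType a b)
    (h' : SameCycleType b c) : SameCycleType a c := by
  obtain ⟨μ, h1, h2⟩ := h
  obtain ⟨ν, h3, h4⟩ := h'
  obtain rfl := h2.unique h3
  exact ⟨μ, h1, h4⟩

open SemigroupConj

/-! ### Conjugacy in monoids mapped to the partition monoid -/

section Submonoid

variable {M : Type*} [Monoid M] (ι : M →* PartitionMonoid n)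

theorem map_greenR {a b : M} (h : GreenR a b) : GreenR (ι a) (ι b) := by
  obtain ⟨⟨x, rfl⟩, y, hy⟩ := h
  exact ⟨⟨ι x, by simp⟩, ι y, by rw [← map_mul, hy]⟩

theorem map_greenL {a b : M} (h : GreenL a b) : GreenL (ι a) (ι b) := by
  obtain ⟨⟨x, rfl⟩, y, hy⟩ := h
  exact ⟨⟨ι x, by simp⟩, ι y, by rw [← map_mul, hy]⟩

variable [Finite M]

theorem map_omega_mul_self (a : M) : ι (omega a) * ι (omega a) = ι (omega a) := by
  rw [← map_mul, (isOmega_omega a).1.eq]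

theorem upperEq_omegaSucc (a : M) : UpperEq (ι (omegaSucc a)) (ι (omega a)) :=
  upperEq_of_greenR (map_greenR ι (greenH_omegaSucc a).1)

theorem lowerEq_omegaSucc (a : M) : LowerEq (ι (omegaSucc a)) (ι (omega a)) :=
  lowerEq_of_greenL (map_greenL ι (greenH_omegaSucc a).2)

theorem isGroupElement_omegaSucc (a : M) : IsGroupElement (ι (omegaSucc a)) :=
  ⟨ι (omega a), map_omega_mul_self ι a, map_greenR ι (greenH_omegaSucc a).1,
    map_greenL ι (greenH_omegaSucc a).2⟩

theorem isGroupLike_omegaSucc (a : M) : IsGroupLike (ι (omegaSucc a)) :=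
  (isGroupLike_of_idem (map_omega_mul_self ι a)).of_eq (upperEq_omegaSucc ι a)
    (lowerEq_omegaSucc ι a)

theorem realizes_omega (a : M) :
    Realizes (ι (omegaSucc a)) (ι (omegaSucc a)) (Equiv.refl _) (ι (omega a)) :=
  realizes_one_of_idem (map_omega_mul_self ι a) (upperEq_omegaSucc ι a).symm
    (lowerEq_omegaSucc ι a).symm

theorem exists_realizes_omegaSucc (a : M) :
    ∃ τ, Realizes (ι (omegaSucc a)) (ι (omegaSucc a)) τ (ι (omegaSucc a)) :=
  exists_realizes_of_rows (isGroupLike_omegaSucc ι a) (isGroupLike_omegaSucc ι a) (.refl _)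
    (.refl _)

/-- The elements `g` and `h` correspond to bijections `φ` and `ψ` between the transversal classes.
The equation `h * g = omega b` forces `ψ` to be the inverse of `φ`, and the last equation then says
that `φ` conjugates one permutation into the other. -/
theorem sameCycleType_of_traceConj {a b : M} (h : TraceConj a b) :
    SameCycleType (ι (omegaSucc a)) (ι (omegaSucc b)) := by
  obtain ⟨g, h, h1, h2, h3, h4, h5⟩ := h
  have ha := isGroupLike_omegaSucc ι a
  have hb := isGroupLike_omegaSucc ι b
  obtain ⟨τ, hτ⟩ := exists_realizes_omegaSucc ι a
  obtain ⟨σ, hσ⟩ := exists_realizes_omegaSucc ι b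
  -- The equations between `g` and `h` place `g` in the `R`-class of `omega a` and the `L`-class of
  -- `omega b`, and `h` the other way round; this fixes their rows.
  have gR : GreenR g (omega a) := ⟨⟨g, by rw [← h3, h1]⟩, h, h3⟩
  have gL : GreenL g (omega b) := ⟨⟨g, by rw [← h4, ← mul_assoc, h1]⟩, h, h4⟩
  have hR : GreenR h (omega b) := ⟨⟨h, by rw [← h4, h2]⟩, g, h4⟩
  have hL : GreenL h (omega a) := ⟨⟨h, by rw [← h3, ← mul_assoc, h2]⟩, g, h3⟩
  obtain ⟨φ, hφ⟩ := exists_realizes_of_rows ha hb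
    ((upperEq_of_greenR (map_greenR ι gR)).trans (upperEq_omegaSucc ι a).symm)
    ((lowerEq_of_greenL (map_greenL ι gL)).trans (lowerEq_omegaSucc ι b).symm)
  obtain ⟨ψ, hψ⟩ := exists_realizes_of_rows hb ha
    ((upperEq_of_greenR (map_greenR ι hR)).trans (upperEq_omegaSucc ι b).symm)
    ((lowerEq_of_greenL (map_greenL ι hL)).trans (lowerEq_omegaSucc ι a).symm)
  have e1 := hψ.mul hb ha hb hφ
  rw [← map_mul, h4] at e1
  have e2 := e1.unique hb (realizes_omega ι b)
  have e3 := (hψ.mul hb ha ha hτ).mul hb ha hb hφ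
  rw [← map_mul, ← map_mul, h5] at e3
  have e4 : φ.permCongr τ = σ := by
    rw [← e3.unique hb hσ]
    ext Q
    have : ψ Q = φ.symm Q := by
      rw [Equiv.eq_symm_apply]
      exact congrArg (fun f => f Q) e2
    simp [Equiv.permCongr_apply, this]
  exact ⟨_, ⟨isGroupElement_omegaSucc ι a, τ, hτ.isTransversalPerm ha, rfl⟩,
    isGroupElement_omegaSucc ι b, σ, hσ.isTransversalPerm hb, by
      rw [← e4, Equiv.Perm.parts_partition_permCongr]⟩

/-- A bijection conjugating the permutations and its inverse are realized by partitions, which `hM`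
pulls back to `M`. Each required equation holds because both sides realize the same bijection
between the same rows. -/
theorem traceConj_of_sameCycleType (hι : Function.Injective ι)
    (hM : ∀ (c d : M) (z : PartitionMonoid n), UpperEq z (ι c) → LowerEq z (ι d) → ∃ g, ι g = z)
    {a b : M} (h : SameCycleType (ι (omegaSucc a)) (ι (omegaSucc b))) : TraceConj a b := by
  obtain ⟨μ, ⟨-, τ', hτ', rfl⟩, -, σ', hσ', hμ⟩ := h
  have ha := isGroupLike_omegaSucc ι a
  have hb := isGroupLike_omegaSucc ι b
  obtain ⟨τ, hτ⟩ := exists_realizes_omegaSucc ι a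
  obtain ⟨σ, hσ⟩ := exists_realizes_omegaSucc ι b
  obtain rfl := hτ'.unique (hτ.isTransversalPerm ha)
  obtain rfl := hσ'.unique (hσ.isTransversalPerm hb)
  obtain ⟨φ, hφ⟩ := Equiv.Perm.exists_permCongr_eq hμ.symm
  obtain ⟨z, hz⟩ := exists_realizes ha hb φ
  obtain ⟨w, hw⟩ := exists_realizes hb ha φ.symm
  obtain ⟨g, rfl⟩ := hM _ _ z hz.upper hz.lower
  obtain ⟨h, rfl⟩ := hM _ _ w hw.upper hw.lower
  have e1 := hz.mul ha hb ha hw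
  have e2 := hw.mul hb ha hb hz
  rw [Equiv.self_trans_symm] at e1
  rw [Equiv.symm_trans_self] at e2
  have e3 := e1.mul ha ha hb hz
  have e4 := e2.mul hb hb ha hw
  rw [Equiv.refl_trans] at e3 e4
  have e5 := (hw.mul hb ha ha hτ).mul hb ha hb hz
  have e6 : (φ.symm.trans τ').trans φ = σ' := by
    rw [← hφ]
    rfl
  rw [e6] at e5
  simp only [← map_mul] at e1 e2 e3 e4 e5
  exact ⟨g, h, hι (e3.eq hz), hι (e4.eq hw), hι (e1.eq (realizes_omega ι a)),
    hι (e2.eq (realizes_omega ι b)), hι (e5.eq hσ)⟩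

/-- The characterization of conjugacy in a submonoid of the partition monoid that is regular and
contains the partitions composed of rows of its elements. -/
theorem conj_iff (hι : Function.Injective ι)
    (hM : ∀ (c d : M) (z : PartitionMonoid n), UpperEq z (ι c) → LowerEq z (ι d) → ∃ g, ι g = z)
    (hreg : ∀ a : M, ∃ x, a * x * a = a) (a b : M) :
    (PrimaryConjStar a b ↔ TraceConj a b) ∧
      (PrimaryConjStar a b ↔ SameCycleType (ι (omegaSucc a)) (ι (omegaSucc b))) := by
  have h1 : PrimaryConjStar a b → SameCycleType (ι (omegaSucc a)) (ι (omegaSucc b)) := by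
    intro h
    induction h with
    | single h => exact sameCycleType_of_traceConj ι h.traceConj
    | tail _ h ih => exact ih.trans (sameCycleType_of_traceConj ι h.traceConj)
  have h2 := @traceConj_of_sameCycleType n M _ ι _ hι hM a b
  have h3 : TraceConj a b → PrimaryConjStar a b := fun h => h.primaryConjStar hreg
  exact ⟨⟨fun h => h2 (h1 h), h3⟩, h1, fun h => h3 (h2 h)⟩

end Submonoid

/-! ### Rows and flips in the Brauer monoids -/

/-- Blocks inside the upper row are inherited unchanged, so only transversal blocks need a new
count. -/
theorem UpperEq.block_eq {z c : PartitionMonoid n} (h : UpperEq z c) {x : Fin n}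
    (hx : ¬ c.Dom x) : z.block (.inl x) = c.block (.inl x) := by
  ext (y | y)
  · exact h.1 x y
  · exact ⟨fun hy => absurd ((h.2 x).1 ⟨y, hy⟩) hx, fun hy => absurd ⟨y, hy⟩ hx⟩

theorem block_eq_pair {c : PartitionMonoid n} (hc : ∀ p, (c.block p).ncard ≤ 2) {p q}
    (h : c.Rel p q) (hpq : p ≠ q) : c.block p = {p, q} := by
  refine (Set.eq_of_subset_of_ncard_le ?_ ?_ (Set.toFinite _)).symm
  · rintro r (rfl | rfl)
    · exact c.rel_refl _
    · exact h
  · rw [Set.ncard_pair hpq]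
    exact hc p

theorem UpperEq.eq_of_rel {z c : PartitionMonoid n} (h : UpperEq z c)
    (hc : ∀ p, (c.block p).ncard ≤ 2) {x x'} (hx : c.Dom x)
    (hxx : z.Rel (.inl x) (.inl x')) : x' = x := by
  obtain ⟨u, hu⟩ := hx
  have : Sum.inl x' ∈ c.block (.inl x) := (h.1 _ _).1 hxx
  rw [block_eq_pair hc hu Sum.inl_ne_inr] at this
  simpa using this

theorem LowerEq.eq_of_rel {z c : PartitionMonoid n} (h : LowerEq z c)
    (hc : ∀ p, (c.block p).ncard ≤ 2) {x x'} (hx : c.Cod x)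
    (hxx : z.Rel (.inr x) (.inr x')) : x' = x := by
  obtain ⟨u, hu⟩ := hx
  have : Sum.inr x' ∈ c.block (.inr x) := (h.1 _ _).1 hxx
  rw [block_eq_pair hc (c.rel_symm hu) Sum.inr_ne_inl] at this
  simpa using this

theorem ncard_block_inl {z c d : PartitionMonoid n} (h : UpperEq z c) (h' : LowerEq z d)
    (hc : ∀ p, (c.block p).ncard ≤ 2) (hd : ∀ p, (d.block p).ncard ≤ 2) (x : Fin n) :
    (z.block (.inl x)).ncard = 2 ∨ (z.block (.inl x)).ncard = (c.block (.inl x)).ncard := by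
  by_cases hx : c.Dom x
  · left
    obtain ⟨y, hy⟩ := (h.2 x).2 hx
    have : z.block (.inl x) = {.inl x, .inr y} := by
      ext (v | v)
      · simp only [Set.mem_insert_iff, Sum.inl.injEq, Set.mem_singleton_iff, reduceCtorEq, or_false]
        exact ⟨fun hv => h.eq_of_rel hc hx hv, fun hv => by rw [hv]; exact z.rel_refl _⟩
      · simp only [Set.mem_insert_iff, Sum.inr.injEq, Set.mem_singleton_iff, reduceCtorEq, false_or]
        exact ⟨fun hv => h'.eq_of_rel hd ((h'.2 y).1 ⟨x, hy⟩) (coker_of_rel hy hv),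
          fun hv => by rw [hv]; exact hy⟩
    rw [this, Set.ncard_pair Sum.inl_ne_inr]
  · exact .inr (by rw [h.block_eq hx])

theorem ncard_block_flip (a : PartitionMonoid n) (p) :
    (a.flip.block p).ncard = (a.block p.swap).ncard := by
  rw [← Set.ncard_image_of_injective (a.flip.block p) (Equiv.sumComm (Fin n) (Fin n)).injective]
  congr 1
  ext q
  simp only [Equiv.sumComm_apply, Set.mem_image]
  constructor
  · rintro ⟨q, h, rfl⟩
    exact h
  · exact fun h => ⟨q.swap, by simpa [block, flip_rel] using h, by simp⟩

theorem UpperEq.flip {z c : PartitionMonoid n} (h : UpperEq z c) : LowerEq z.flip c.flip := by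
  refine ⟨h.1, fun x => ?_⟩
  exact (exists_congr fun _ => flip_inl_inr).trans
    ((h.2 x).trans (exists_congr fun _ => flip_inl_inr.symm))

theorem LowerEq.flip {z c : PartitionMonoid n} (h : LowerEq z c) : UpperEq z.flip c.flip := by
  refine ⟨h.1, fun x => ?_⟩
  exact (exists_congr fun _ => flip_inl_inr).trans
    ((h.2 x).trans (exists_congr fun _ => flip_inl_inr.symm))

/-- A transversal block of `z` joins one upper vertex to one lower vertex, and every other block
comes from `c` or `d`. The disjunction serves both the bound `≤ 2` and the equality `= 2`; the lower
row follows by flipping. -/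
theorem ncard_block_of_rows {z c d : PartitionMonoid n} (h : UpperEq z c) (h' : LowerEq z d)
    (hc : ∀ p, (c.block p).ncard ≤ 2) (hd : ∀ p, (d.block p).ncard ≤ 2) (p) :
    (z.block p).ncard = 2 ∨ ∃ e ∈ ({c, d} : Set (PartitionMonoid n)),
      (z.block p).ncard = (e.block p).ncard := by
  rcases p with x | x
  · exact (ncard_block_inl h h' hc hd x).imp_right fun h => ⟨c, by simp, h⟩
  · have := ncard_block_inl h'.flip h.flip (fun p => (ncard_block_flip d p).trans_le (hd _))
      (fun p => (ncard_block_flip c p).trans_le (hc _)) x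
    rw [ncard_block_flip, ncard_block_flip] at this
    exact this.imp_right fun h => ⟨d, by simp, h⟩

end PartitionMonoid

/-! ### The three monoids -/

theorem mainTheorem6 (n : ℕ) :
    (∀ a b : PartitionMonoid n,
      (SemigroupConj.PrimaryConjStar a b ↔ SemigroupConj.TraceConj a b) ∧
      (SemigroupConj.PrimaryConjStar a b ↔
        PartitionMonoid.SameCycleType (SemigroupConj.omegaSucc a) (SemigroupConj.omegaSucc b))) ∧
    (∀ a b : PartitionMonoid.PartialBrauer n,
      (SemigroupConj.PrimaryConjStar a b ↔ SemigroupConj.TraceConj a b) ∧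
      (SemigroupConj.PrimaryConjStar a b ↔
        PartitionMonoid.SameCycleType ((SemigroupConj.omegaSucc a : PartitionMonoid.PartialBrauer n) : PartitionMonoid n)
          ((SemigroupConj.omegaSucc b : PartitionMonoid.PartialBrauer n) : PartitionMonoid n))) ∧
    (∀ a b : PartitionMonoid.Brauer n,
      (SemigroupConj.PrimaryConjStar a b ↔ SemigroupConj.TraceConj a b) ∧
      (SemigroupConj.PrimaryConjStar a b ↔
        PartitionMonoid.SameCycleType ((SemigroupConj.omegaSucc a : PartitionMonoid.Brauer n) : PartitionMonoid n)
          ((SemigroupConj.omegaSucc b : PartitionMonoid.Brauer n) : PartitionMonoid n))) := by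
  refine ⟨?_, ?_, ?_⟩
  · exact PartitionMonoid.conj_iff (MonoidHom.id _) Function.injective_id (fun _ _ z _ _ => ⟨z, rfl⟩)
      fun a => ⟨a.flip, PartitionMonoid.mul_flip_mul a⟩
  -- Flipping preserves block sizes, so the regular inverse `a.flip` stays in the submonoid.
  · refine PartitionMonoid.conj_iff (PartitionMonoid.PartialBrauer n).subtype Subtype.val_injective (fun c d z h h' => ?_)
      fun a => ⟨⟨a.1.flip, fun p => (PartitionMonoid.ncard_block_flip a.1 p).trans_le (a.2 _)⟩,
        Subtype.ext (PartitionMonoid.mul_flip_mul a.1)⟩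
    refine ⟨⟨z, fun p => ?_⟩, rfl⟩
    rcases PartitionMonoid.ncard_block_of_rows h h' c.2 d.2 p with h | ⟨e, rfl | rfl, h⟩
    · exact h.le
    · exact h.trans_le (c.2 p)
    · exact h.trans_le (d.2 p)
  · refine PartitionMonoid.conj_iff (PartitionMonoid.Brauer n).subtype Subtype.val_injective (fun c d z h h' => ?_)
      fun a => ⟨⟨a.1.flip, fun p => (PartitionMonoid.ncard_block_flip a.1 p).trans (a.2 _)⟩,
        Subtype.ext (PartitionMonoid.mul_flip_mul a.1)⟩
    refine ⟨⟨z, fun p => ?_⟩, rfl⟩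
    rcases PartitionMonoid.ncard_block_of_rows h h' (fun p => (c.2 p).le) (fun p => (d.2 p).le) p with
      h | ⟨e, rfl | rfl, h⟩
    · exact h
    · exact h.trans (c.2 p)
    · exact h.trans (d.2 p)
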